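/- Let $\nu$ be a non-zero finite Borel measure on the open interval $(0,1)$. **$L^q$-spectrum.** For $n\in\mathbb N$ and $0\le k<2^n$ put $A_n^k=(k2^{-n},(k+1)2^{-n}]$, and for $q\in\mathbb R$ put $$\beta_n(q)=\frac{1}{\log 2^n}\log\sum_{k\,:\,\nu(A_n^k)>0}\nu(A_n^k)^q,\qquad \beta_\nu(q)=\limsup_{n\to\infty}\beta_n(q)\in[-\infty,\infty].$$ For all sufficiently large $n$ the function $\beta_n$ has exactly one fixed point $q_n\in\mathbb R$, $\beta_n(q_n)=q_n$; put $\overline q_\nu=\limsup_{n\to\infty}q_n$. The measure $\nu$ is called *$L^q$-regular* if * there is $\varepsilon>0$ with $\beta_\nu(q)=\liminf_{n}\beta_n(q)$ for all $q\in(\overline q_\nu-\varepsilon,\overline q_\nu)$, or * $\beta_\nu(\overline q_\nu)=\liminf_n\beta_n(\overline q_\nu)$, and $\beta_\nu$ is finite near $\overline q_\nu$ and differentiable at $\overline q_\nu$. **Optimized coarse multifractal dimensions.** For $\alpha>0$ let $\mathcal N_\alpha(n)$ be the number of $k\in\{0,\dots,2^n-1\}$ with $\nu(A_n^k)\ge 2^{-\alpha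 n}$, and put $$\overline F_\nu=\sup_{\alpha>0}\frac{1}{1+\alpha}\limsup_{n\to\infty}\frac{\log^+\mathcal N_\alpha(n)}{\log 2^n},\qquad \underline F_\nu=\sup_{\alpha>0}\frac{1}{1+\alpha}\liminf_{n\to\infty}\frac{\log^+\mathcal N_\alpha(n)}{\log 2^n}.$$ The measure $\nu$ is called *MF-regular* if $\underline F_\nu=\overline F_\nu$. **Spectral dimension.** Let $\mathcal D_\nu$ be the space of all continuous $f:[0,1]\to\mathbb R$ with $f(0)=f(1)=0$ that are of the form $f(x)=\int_0^x\nabla f\,d\Lambda$ with $\nabla f\in L^2([0,1],\Lambda)$, where $\Lambda$ is Lebesgue measure, and that are affine on each connected component of $[0,1]\setminus\operatorname{supp}\nu$. A function $f\in\mathcal D_\nu\setminus\{0\}$ is an eigenfunction with eigenvalue $\lambda$ if $\int_0^1\nabla f\,\nabla g\,d\Lambda=\lambda\int fg\,d\nu$ for all $g\in\mathcal D_\nu$. Let $N_\nu(x)$ be the number of eigenvalues not exceeding $x$, counted with multiplicity. The spectral dimension of $\nu$ exists and equals $s$ if $$\liminf_{x\to\infty}\frac{\log N_\nu(x)}{\log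 x}=\limsup_{x\to\infty}\frac{\log N_\nu(x)}{\log x}=s.$$ **Theorem.** If $\nu$ is $L^q$-regular, then $\nu$ is MF-regular, and the spectral dimension of $\nu$ exists and equals $\overline q_\nu$. -/

import Mathlib

open Set Filter Topology MeasureTheory
open scoped ENNReal

noncomputable section

namespace KreinFeller

/-! Throughout, `ν` is a finite Borel measure on the open interval `(0,1)`, represented as a
measure on `ℝ` with `ν (Ioo 0 1)ᶜ = 0`. -/

/-! ### The Kreĭn-Feller form and its eigenvalue counting function -/

/-- `g` is a square integrable derivative of `f` on `[0,1]`: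
`g ∈ L²([0,1])` and `f x = f 0 + ∫_{[0,x]} g` for all `x ∈ [0,1]`. -/
def HasGrad (f g : ℝ → ℝ) : Prop :=
  MemLp g 2 (volume.restrict (Icc 0 1)) ∧
    ∀ x ∈ Icc (0 : ℝ) 1, f x = f 0 + ∫ t in Icc 0 x, g t

/-- The Sobolev space `H¹₀(0,1)`. Its elements are functions on `[0,1]` that vanish at `0` and `1`;
they are represented by their extensions by zero to `ℝ`. -/
def H10 : Set (ℝ → ℝ) :=
  {f | (∃ g, HasGrad f g) ∧ ∀ x, x ∉ Ioo (0 : ℝ) 1 → f x = 0}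

open Classical in
/-- The weak derivative of `f` on `[0,1]` (unique up to Lebesgue null sets where it exists). -/
def grad (f : ℝ → ℝ) : ℝ → ℝ :=
  if h : ∃ g, HasGrad f g then h.choose else 0

/-- The functions that are continuous on `[0,1]` and affine on each connected component of
`[0,1] \ supp ν`. -/
def Cnu (ν : Measure ℝ) : Set (ℝ → ℝ) :=
  {f | ContinuousOn f (Icc 0 1) ∧
    ∀ x ∈ Icc (0 : ℝ) 1 \ ν.support, ∃ c d : ℝ,
      ∀ y ∈ connectedComponentIn (Icc (0 : ℝ) 1 \ ν.support) x, f y = c * y + d}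

/-- The (Dirichlet) domain of the form. -/
def dom (ν : Measure ℝ) : Set (ℝ → ℝ) := H10 ∩ Cnu ν

/-- The form `∫_{(0,1)} ∇f ∇g dΛ`. -/
def form (f g : ℝ → ℝ) : ℝ := ∫ t in Ioo (0 : ℝ) 1, grad f t * grad g t

/-- `f` is an eigenfunction of the form with eigenvalue `l`. -/
def IsEigenfunction (ν : Measure ℝ) (l : ℝ) (f : ℝ → ℝ) : Prop :=
  f ∈ dom ν ∧ f ≠ 0 ∧ ∀ g ∈ dom ν, form f g = l * ∫ t, f t * g t ∂ν

/-- The eigenvalue counting function: the number of eigenvalues not exceeding `x`, counted with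
multiplicity, i.e. the dimension of the span of all eigenfunctions with eigenvalue at most `x`. -/
def eigenCount (ν : Measure ℝ) (x : ℝ) : ℕ∞ :=
  Cardinal.toENat
    (Module.rank ℝ (Submodule.span ℝ {f : ℝ → ℝ | ∃ l ≤ x, IsEigenfunction ν l f}))

/-- `log N_ν(x) / log x`, as an extended real number. -/
def spectralRatio (ν : Measure ℝ) (x : ℝ) : EReal :=
  ENNReal.log ((eigenCount ν x : ℕ∞) : ℝ≥0∞) / ((Real.log x : ℝ) : EReal)

/-- The lower spectral dimension. -/
def lowerSpectralDim (ν : Measure ℝ) : EReal := liminf (spectralRatio ν) atTop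

/-- The upper spectral dimension. -/
def upperSpectralDim (ν : Measure ℝ) : EReal := limsup (spectralRatio ν) atTop

/-- The spectral dimension exists and equals `s`. -/
def HasSpectralDim (ν : Measure ℝ) (s : ℝ) : Prop :=
  lowerSpectralDim ν = (s : EReal) ∧ upperSpectralDim ν = (s : EReal)

/-! ### The `L^q`-spectrum -/

/-- The dyadic interval `(k 2⁻ⁿ, (k+1) 2⁻ⁿ]`. -/
def dyadic (n k : ℕ) : Set ℝ := Ioc ((k : ℝ) / 2 ^ n) (((k : ℝ) + 1) / 2 ^ n)

open Classical in
/-- `β_n(q) = (log 2ⁿ)⁻¹ log ∑ ν(C)^q`, the sum being over the dyadic intervals `C` of level `n`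
in `(0,1]` with positive measure. -/
def betaN (ν : Measure ℝ) (n : ℕ) (q : ℝ) : ℝ :=
  Real.log (∑ k ∈ (Finset.range (2 ^ n)).filter (fun k => 0 < ν (dyadic n k)),
    ν.real (dyadic n k) ^ q) / Real.log (2 ^ n)

/-- For all large `n` the function `β_n` has exactly one fixed point. -/
theorem eventually_existsUnique_fixedPoint (ν : Measure ℝ) [IsFiniteMeasure ν] (hν : ν ≠ 0)
    (hsupp : ν (Ioo 0 1)ᶜ = 0) : ∀ᶠ n : ℕ in atTop, ∃! q : ℝ, betaN ν n q = q := by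
  classical
  have h1 : ∀ᶠ n : ℕ in atTop, ν.real univ < (2 : ℝ) ^ n :=
    (tendsto_pow_atTop_atTop_of_one_lt (by norm_num : (1 : ℝ) < 2)).eventually_gt_atTop _
  filter_upwards [h1, eventually_ge_atTop 1] with n hn hn1
  set S := (Finset.range (2 ^ n)).filter (fun k => 0 < ν (dyadic n k)) with hS
  have h2n : (0 : ℝ) < 2 ^ n := by positivity
  have hlog : 0 < Real.log ((2 : ℝ) ^ n) :=
    Real.log_pos (one_lt_pow₀ (by norm_num) (by omega))
  have hcover : Ioo (0 : ℝ) 1 ⊆ ⋃ k ∈ Finset.range (2 ^ n), dyadic n k := by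
    intro x hx
    have hy : 0 < x * 2 ^ n := mul_pos hx.1 h2n
    have hc : 0 < ⌈x * 2 ^ n⌉₊ := Nat.ceil_pos.2 hy
    obtain ⟨k, hk⟩ : ∃ k, ⌈x * 2 ^ n⌉₊ = k + 1 := ⟨_, (Nat.succ_pred_eq_of_pos hc).symm⟩
    have hle := Nat.le_ceil (x * 2 ^ n)
    have hlt : ((k : ℕ) : ℝ) < x * 2 ^ n := Nat.lt_ceil.1 (by omega)
    rw [hk] at hle
    push_cast at hle
    have hk2 : k < 2 ^ n := by
      have : (k : ℝ) < 2 ^ n := hlt.trans (by nlinarith [hx.2])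
      exact_mod_cast this
    simp only [mem_iUnion, Finset.mem_range]
    exact ⟨k, hk2, (div_lt_iff₀ h2n).2 hlt, (le_div_iff₀ h2n).2 hle⟩
  have hSne : S.Nonempty := by
    by_contra hne
    rw [Finset.not_nonempty_iff_eq_empty, hS, Finset.filter_eq_empty_iff] at hne
    have h0 : ν (Ioo 0 1) = 0 := by
      refine measure_mono_null hcover ?_
      exact measure_iUnion_null fun k => measure_iUnion_null fun hk => by simpa using hne hk
    apply hν
    rw [← Measure.measure_univ_eq_zero, ← union_compl_self (Ioo (0 : ℝ) 1)]
    exact measure_union_null h0 hsupp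
  have hp : ∀ k ∈ S, 0 < ν.real (dyadic n k) := fun k hk =>
    ENNReal.toReal_pos (Finset.mem_filter.1 hk).2.ne' (measure_ne_top _ _)
  have hb0 : ∀ k ∈ S, 0 < ν.real (dyadic n k) / 2 ^ n := fun k hk => div_pos (hp k hk) h2n
  have hb1 : ∀ k ∈ S, ν.real (dyadic n k) / 2 ^ n < 1 := fun k _ =>
    (div_lt_one h2n).2 ((measureReal_mono (subset_univ _)).trans_lt hn)
  set g : ℝ → ℝ := fun q => ∑ k ∈ S, (ν.real (dyadic n k) / 2 ^ n) ^ q with hg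
  have hiff : ∀ q, betaN ν n q = q ↔ g q = 1 := by
    intro q
    have hsum : 0 < ∑ k ∈ S, ν.real (dyadic n k) ^ q :=
      Finset.sum_pos (fun k hk => Real.rpow_pos_of_pos (hp k hk) q) hSne
    have hgq : g q = (∑ k ∈ S, ν.real (dyadic n k) ^ q) / ((2 : ℝ) ^ n) ^ q := by
      rw [hg, Finset.sum_div]
      exact Finset.sum_congr rfl fun k hk => Real.div_rpow (hp k hk).le h2n.le q
    have hpow : 0 < ((2 : ℝ) ^ n) ^ q := Real.rpow_pos_of_pos h2n q
    rw [hgq, div_eq_one_iff_eq hpow.ne', betaN, div_eq_iff hlog.ne', ← Real.log_rpow h2n]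
    exact ⟨fun h => Real.log_injOn_pos hsum hpow h, fun h => congrArg _ h⟩
  have hanti : StrictAnti g := fun a b hab =>
    Finset.sum_lt_sum_of_nonempty hSne fun k hk =>
      Real.rpow_lt_rpow_of_exponent_gt (hb0 k hk) (hb1 k hk) hab
  have hcont : Continuous g :=
    continuous_finsetSum _ fun k hk =>
      Real.continuous_const_rpow (hb0 k hk).ne'
  have hlim : Tendsto g atTop (𝓝 0) := by
    have := tendsto_finsetSum S fun k hk =>
      tendsto_rpow_atTop_of_base_lt_one _ (by linarith [hb0 k hk]) (hb1 k hk)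
    simpa using this
  have hg0 : 1 ≤ g 0 := by
    simp only [hg, Real.rpow_zero, Finset.sum_const, nsmul_eq_mul, mul_one]
    exact_mod_cast hSne.card_pos
  obtain ⟨b, hb, hb'⟩ := ((hlim.eventually_lt_const one_pos).and (eventually_ge_atTop 0)).exists
  obtain ⟨q, -, hq⟩ := intermediate_value_Icc' hb' hcont.continuousOn ⟨hb.le, hg0⟩
  exact ⟨q, (hiff q).2 hq, fun r hr => hanti.injective (((hiff r).1 hr).trans hq.symm)⟩

/-- The `L^q`-spectrum `β_ν(q) = limsup β_n(q)`; it may be infinite for `q < 0`. -/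
def beta (ν : Measure ℝ) (q : ℝ) : EReal :=
  limsup (fun n : ℕ => ((betaN ν n q : ℝ) : EReal)) atTop

/-- `liminf β_n(q)`. -/
def lowerBeta (ν : Measure ℝ) (q : ℝ) : EReal :=
  liminf (fun n : ℕ => ((betaN ν n q : ℝ) : EReal)) atTop

/-- The fixed point `q_n` of `β_n`. For a non-zero finite measure and all large `n` the set of fixed
points has exactly one element (lemma `eventually_existsUnique_fixedPoint`), so the infimum is that
element. -/
def fixedPt (ν : Measure ℝ) (n : ℕ) : ℝ := sInf (Function.fixedPoints (betaN ν n))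

/-- `limsup q_n` (the sequence is bounded). -/
def qBar (ν : Measure ℝ) : ℝ := limsup (fixedPt ν) atTop

/-- `L^q`-regularity: `β_ν = liminf β_n` on some interval `(q̄ - ε, q̄)`, or `β_ν = liminf β_n` at
`q̄` and `β_ν` is (finite near `q̄` and) differentiable at `q̄`. -/
def LqRegular (ν : Measure ℝ) : Prop :=
  (∃ ε > 0, ∀ q ∈ Ioo (qBar ν - ε) (qBar ν), beta ν q = lowerBeta ν q) ∨
  (beta ν (qBar ν) = lowerBeta ν (qBar ν) ∧
    (∀ᶠ q in 𝓝 (qBar ν), beta ν q ≠ ⊤ ∧ beta ν q ≠ ⊥) ∧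
    DifferentiableAt ℝ (fun q => (beta ν q).toReal) (qBar ν))

/-! ### Optimized coarse multifractal dimensions -/

open Classical in
/-- The number of dyadic intervals of level `n` in `(0,1]` with measure at least `2^{-αn}`. -/
def coarseCount (ν : Measure ℝ) (α : ℝ) (n : ℕ) : ℕ :=
  ((Finset.range (2 ^ n)).filter
    (fun k => (2 : ℝ) ^ (-α * n) ≤ ν.real (dyadic n k))).card

/-- `log⁺ N_α(n) / log 2ⁿ`, a number in `[0,1]`. -/
def coarseRatio (ν : Measure ℝ) (α : ℝ) (n : ℕ) : ℝ :=
  Real.posLog (coarseCount ν α n) / Real.log (2 ^ n)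

/-- The upper optimized coarse multifractal dimension. -/
def upperF (ν : Measure ℝ) : ℝ :=
  ⨆ α : Ioi (0 : ℝ), limsup (coarseRatio ν α) atTop / (1 + (α : ℝ))

/-- The lower optimized coarse multifractal dimension. -/
def lowerF (ν : Measure ℝ) : ℝ :=
  ⨆ α : Ioi (0 : ℝ), liminf (coarseRatio ν α) atTop / (1 + (α : ℝ))

/-- `ν` is MF-regular. -/
def MFRegular (ν : Measure ℝ) : Prop := lowerF ν = upperF ν

end KreinFeller

end

/-
By the min-max principle, `N_ν x` is the largest dimension of a space of Dirichlet functions on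
which `∫ (∇f)² dΛ ≤ x ∫ f² dν`. Call a dyadic interval of level `n` heavy at `t` if its mass is at
least `2 ^ n * t`. A function vanishing at the endpoints of the maximal intervals that are light at
`1 / (2 * x)` has energy at least `2 * x` times its `ν`-norm, so `N_ν x` is at most the number of
heavy intervals, which the partition functions at exponents above `q̄` control; this gives `q̄` as
an upper bound. Conversely, bumps supported near every third interval of mass at least `2 ^ (-α n)`
have disjoint supports and Rayleigh quotient at most a constant times `2 ^ ((1 + α) n)`, so the
coarse counts bound `N_ν` from below.

It remains to see `q̄ ≤ F̲`. At a point `q` where `β_n` converges to `β` and `β` is differentiable,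
intervals whose mass is far from `2 ^ (-α n)`, with `α = -β'(q)`, contribute negligibly to the
partition function, so about `2 ^ (n (β(q) + α q))` intervals have mass about `2 ^ (-α n)`. Such
points are found at, or arbitrarily close to the left of, `q̄`, because `β` is monotone.
-/

open Set Filter Topology MeasureTheory
open scoped ENNReal

noncomputable section

namespace KreinFeller

open scoped InnerProductSpace

/-! ### Min-max estimates for compact positive operators -/

section MinMax

open Module.End RCLike

theorem rank_le_of_disjoint_orthogonal {𝕜 E : Type*} [RCLike 𝕜] [NormedAddCommGroup E]
    [InnerProductSpace 𝕜 E] {V W : Submodule 𝕜 E} [W.HasOrthogonalProjection]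
    (h : Disjoint V Wᗮ) : Module.rank 𝕜 V ≤ Module.rank 𝕜 W := by
  refine LinearMap.rank_le_of_injective
    ((W.orthogonalProjectionOnto : E →ₗ[𝕜] W) ∘ₗ V.subtype) ?_
  rw [← LinearMap.ker_eq_bot, LinearMap.ker_eq_bot']
  intro v hv
  exact Subtype.ext (Submodule.disjoint_def.1 h v v.2
    (Submodule.orthogonalProjectionOnto_eq_zero_iff.1 hv))

variable {𝕜 E F : Type*} [RCLike 𝕜] [NormedAddCommGroup E] [InnerProductSpace 𝕜 E]
  [NormedAddCommGroup F] [NormedSpace 𝕜 F]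

/-- The span of the eigenvectors of `T` whose eigenvalue is the reciprocal of a number in `(0, x]`.
For the inverse `T` of an unbounded positive operator `A` this is the spectral subspace of `A`
belonging to the eigenvalues at most `x`. -/
def lowSpace (T : E →L[𝕜] E) (x : ℝ) : Submodule 𝕜 E :=
  ⨆ l : Ioc 0 x, eigenspace (T : E →ₗ[𝕜] E) ((l : ℝ)⁻¹ : ℝ)

theorem mem_lowSpace {T : E →L[𝕜] E} {x l : ℝ} (hl : l ∈ Ioc 0 x) {v : E}
    (hv : T v = ((l⁻¹ : ℝ) : 𝕜) • v) : v ∈ lowSpace T x :=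
  Submodule.mem_iSup_of_mem ⟨l, hl⟩ (mem_eigenspace_iff.2 hv)

theorem map_mem_lowSpace {T : E →L[𝕜] E} {x : ℝ} {v : E} (hv : v ∈ lowSpace T x) :
    T v ∈ lowSpace T x := by
  suffices lowSpace T x ≤ (lowSpace T x).comap (T : E →ₗ[𝕜] E) from this hv
  refine iSup_le fun l w hw => ?_
  have hTw : T w = (((l : ℝ)⁻¹ : ℝ) : 𝕜) • w := mem_eigenspace_iff.1 hw
  simpa [hTw] using Submodule.smul_mem _ _ (mem_lowSpace l.2 hTw)

theorem norm_sq_le_of_mem_lowSpace {T : E →L[𝕜] E} (hT : T.IsSymmetric) {x : ℝ} {v : E}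
    (hv : v ∈ lowSpace T x) : ‖v‖ ^ 2 ≤ x * re ⟪T v, v⟫_𝕜 := by
  classical
  obtain ⟨f, rfl⟩ := (Submodule.mem_iSup_iff_exists_dfinsupp' _ _).1 hv
  have horth := hT.orthogonalFamily_eigenspaces.comp (γ := Ioc 0 x)
    (f := fun l => (((l : ℝ)⁻¹ : ℝ) : 𝕜))
    fun l m h => Subtype.ext (inv_injective (ofReal_injective h))
  have hTf : ∀ l, T (f l : E) = ((((l : ℝ)⁻¹ : ℝ) : 𝕜) • f l : E) :=
    fun l => mem_eigenspace_iff.1 (f l).2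
  have hnorm : ‖∑ l ∈ f.support, (f l : E)‖ ^ 2 = ∑ l ∈ f.support, ‖f l‖ ^ 2 :=
    horth.norm_sum f f.support
  have hinner : re ⟪T (∑ l ∈ f.support, (f l : E)), ∑ l ∈ f.support, (f l : E)⟫_𝕜 =
      ∑ l ∈ f.support, (l : ℝ)⁻¹ * ‖f l‖ ^ 2 := by
    rw [map_sum, Finset.sum_congr rfl fun l _ => hTf l]
    refine (congrArg re (horth.inner_sum (fun l => (((l : ℝ)⁻¹ : ℝ) : 𝕜) • f l) f f.support)).trans
      ?_
    simp only [map_sum, inner_smul_left, conj_ofReal, re_ofReal_mul, inner_self_eq_norm_sq]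
  simp only [DFinsupp.sum]
  rw [hnorm, hinner, Finset.mul_sum]
  refine Finset.sum_le_sum fun l _ => ?_
  rw [← mul_assoc, ← div_eq_mul_inv]
  exact le_mul_of_one_le_left (sq_nonneg _) ((one_le_div l.2.1).2 l.2.2)

theorem rank_lowSpace_le {T : E →L[𝕜] E} (hT : T.IsSymmetric) {x : ℝ} {G : Submodule 𝕜 E}
    [FiniteDimensional 𝕜 G] (hG : ∀ v ∈ Gᗮ, v ≠ 0 → x * re ⟪T v, v⟫_𝕜 < ‖v‖ ^ 2) :
    Module.rank 𝕜 (lowSpace T x) ≤ Module.rank 𝕜 G := by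
  refine rank_le_of_disjoint_orthogonal (Submodule.disjoint_def.2 fun v hv hv' => ?_)
  by_contra hv0
  exact (norm_sq_le_of_mem_lowSpace hT hv).not_gt (hG v hv' hv0)

theorem norm_comp_starProjection_sub_le {S : E →L[𝕜] F} {G : Submodule 𝕜 E}
    [G.HasOrthogonalProjection] {ε : ℝ} (hε : 0 ≤ ε) (h : ∀ u ∈ Gᗮ, ‖S u‖ ≤ ε * ‖u‖) :
    ‖S ∘L G.starProjection - S‖ ≤ ε := by
  refine ContinuousLinearMap.opNorm_le_bound _ hε fun v => ?_
  have hv : (S ∘L G.starProjection - S) v = -S (Gᗮ.starProjection v) := by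
    simp [Submodule.starProjection_orthogonal_val]
  rw [hv, norm_neg]
  exact (h _ (Submodule.starProjection_apply_mem _ v)).trans
    (by gcongr; exact Submodule.norm_starProjection_apply_le _ v)

theorem isCompactOperator_of_small_on_orthogonal [CompleteSpace F] {S : E →L[𝕜] F}
    (h : ∀ ε > 0, ∃ G : Submodule 𝕜 E, FiniteDimensional 𝕜 G ∧ ∀ u ∈ Gᗮ, ‖S u‖ ≤ ε * ‖u‖) :
    IsCompactOperator S := by
  choose G hGfin hG using fun n : ℕ => h (1 / ((n : ℝ) + 1)) (by positivity)
  refine isCompactOperator_of_tendsto (l := atTop) (F := fun n => S ∘L (G n).starProjection)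
    ?_ (Eventually.of_forall fun n => ?_)
  · rw [tendsto_iff_norm_sub_tendsto_zero]
    exact squeeze_zero (fun n => norm_nonneg _)
      (fun n => norm_comp_starProjection_sub_le (by positivity) (hG n))
      tendsto_one_div_add_atTop_nhds_zero_nat
  · have : LocallyCompactSpace (G n) := LocallyCompactSpace.of_finiteDimensional_of_complete 𝕜 _
    exact ((isCompactOperator_of_locallyCompactSpace_dom
      (G n).orthogonalProjectionOnto).clm_comp (G n).subtypeL).clm_comp S

variable [CompleteSpace E]

theorem exists_eigenvector_norm {T : E →L[𝕜] E} (hc : IsCompactOperator T) (hT : T.IsPositive)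
    (hT0 : T ≠ 0) : ∃ v, v ≠ 0 ∧ T v = (‖T‖ : 𝕜) • v := by
  have : Nontrivial E := by
    by_contra h
    rw [not_nontrivial_iff_subsingleton] at h
    exact hT0 (ContinuousLinearMap.ext fun v => Subsingleton.elim _ _)
  have hnorm : (‖T‖ : 𝕜) ≠ 0 := by simpa using hT0
  have hspec : (‖T‖ : 𝕜) ∈ spectrum 𝕜 T := by
    by_contra h
    obtain ⟨ε, hε, hle⟩ := T.rayleighQuotient_le_of_norm_mem_resolventSet (not_not.1 h)
    have : (⨆ v, |T.rayleighQuotient v|) ≤ ‖T‖ - ε := ciSup_le fun v => by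
      have hnonneg : 0 ≤ T.rayleighQuotient v :=
        div_nonneg (hT.re_inner_nonneg_left v) (sq_nonneg _)
      rw [abs_of_nonneg hnonneg]
      exact hle v
    linarith [ContinuousLinearMap.norm_eq_iSup_rayleighQuotient T hT.isSymmetric]
  obtain ⟨v, hv⟩ := ((hc.hasEigenvalue_iff_mem_spectrum hnorm).2 hspec).exists_hasEigenvector
  exact ⟨v, hv.2, hv.apply_eq_smul⟩

theorem lt_norm_sq_of_mem_orthogonal_lowSpace {T : E →L[𝕜] E} (hc : IsCompactOperator T)
    (hT : T.IsPositive) {x : ℝ} {v : E} (hv : v ∈ (lowSpace T x)ᗮ) (hv0 : v ≠ 0) :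
    x * re ⟪T v, v⟫_𝕜 < ‖v‖ ^ 2 := by
  have hinv : ∀ u ∈ (lowSpace T x)ᗮ, T u ∈ (lowSpace T x)ᗮ := fun u hu w hw =>
    (hT.isSymmetric w u).symm.trans (hu _ (map_mem_lowSpace hw))
  let R : (lowSpace T x)ᗮ →L[𝕜] (lowSpace T x)ᗮ := T.restrict hinv
  have hR : R.IsPositive :=
    ⟨hT.isSymmetric.restrict_invariant hinv, fun u => hT.re_inner_nonneg_left (u : E)⟩
  have hxR : x * ‖R‖ < 1 := by
    by_contra! hle
    have hR0 : R ≠ 0 := by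
      rintro h
      norm_num [h] at hle
    have hRpos := norm_pos_iff.2 hR0
    obtain ⟨w, hw0, hw⟩ := exists_eigenvector_norm (hc.restrict' hinv) hR hR0
    have hTw : T (w : E) = (‖R‖ : 𝕜) • (w : E) := congrArg Subtype.val hw
    have hwlow : (w : E) ∈ lowSpace T x :=
      mem_lowSpace ⟨inv_pos.2 hRpos, (inv_le_iff_one_le_mul₀ hRpos).2 hle⟩ (by rwa [inv_inv])
    exact hw0 (Subtype.ext (inner_self_eq_zero.1 (w.2 _ hwlow)))
  have hRv : re ⟪T v, v⟫_𝕜 ≤ ‖R‖ * ‖v‖ ^ 2 := by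
    calc re ⟪T v, v⟫_𝕜 ≤ ‖T v‖ * ‖v‖ := re_inner_le_norm _ _
      _ ≤ ‖R‖ * ‖v‖ * ‖v‖ := by gcongr; exact R.le_opNorm ⟨v, hv⟩
      _ = ‖R‖ * ‖v‖ ^ 2 := by ring
  have hvpos : 0 < ‖v‖ ^ 2 := by positivity
  rcases le_or_gt x 0 with hx | hx
  · exact (mul_nonpos_of_nonpos_of_nonneg hx (hT.re_inner_nonneg_left v)).trans_lt hvpos
  · nlinarith [mul_le_mul_of_nonneg_left hRv hx.le]

theorem rank_le_rank_lowSpace {T : E →L[𝕜] E} (hc : IsCompactOperator T) (hT : T.IsPositive)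
    {x : ℝ} {V : Submodule 𝕜 E} [FiniteDimensional 𝕜 V]
    (hV : ∀ v ∈ V, ‖v‖ ^ 2 ≤ x * re ⟪T v, v⟫_𝕜) :
    Module.rank 𝕜 V ≤ Module.rank 𝕜 (lowSpace T x) := by
  by_contra! hlt
  have : FiniteDimensional 𝕜 (lowSpace T x) :=
    Module.rank_lt_aleph0_iff.1 (hlt.trans (Module.rank_lt_aleph0 𝕜 V))
  refine hlt.not_ge (rank_le_of_disjoint_orthogonal (Submodule.disjoint_def.2 fun v hv hv' => ?_))
  by_contra hv0
  exact (hV v hv).not_gt (lt_norm_sq_of_mem_orthogonal_lowSpace hc hT hv' hv0)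

end MinMax

/-! ### The Sobolev space `H¹₀` as a Hilbert space -/

theorem ae_eq_of_forall_setIntegral_Icc_eq {E : Type*} [NormedAddCommGroup E] [NormedSpace ℝ E]
    [CompleteSpace E] {a b : ℝ} {g h : ℝ → E} (hg : IntegrableOn g (Icc a b))
    (hh : IntegrableOn h (Icc a b))
    (hgh : ∀ x ∈ Icc a b, ∫ t in Icc a x, g t = ∫ t in Icc a x, h t) :
    g =ᵐ[volume.restrict (Icc a b)] h := by
  rcases lt_or_ge b a with hba | hab
  · simp [Icc_eq_empty hba.not_ge, Filter.EventuallyEq]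
  have hg' : IntervalIntegrable g volume a b :=
    (intervalIntegrable_iff_integrableOn_Icc_of_le hab).2 hg
  have hh' : IntervalIntegrable h volume a b :=
    (intervalIntegrable_iff_integrableOn_Icc_of_le hab).2 hh
  rw [Filter.EventuallyEq, ← restrict_Ioo_eq_restrict_Icc, ae_restrict_iff' measurableSet_Ioo]
  filter_upwards [hg'.ae_hasDerivAt_integral, hh'.ae_hasDerivAt_integral] with x hgx hhx hx
  have hxI : x ∈ uIcc a b := uIcc_of_le hab ▸ Ioo_subset_Icc_self hx
  refine (hgx hxI a left_mem_uIcc).unique ((hhx hxI a left_mem_uIcc).congr_of_eventuallyEq ?_)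
  filter_upwards [isOpen_Ioo.mem_nhds hx] with y hy
  simpa only [integral_Icc_eq_integral_Ioc, intervalIntegral.integral_of_le hy.1.le]
    using hgh y (Ioo_subset_Icc_self hy)

theorem sq_integral_le {α : Type*} {mα : MeasurableSpace α} {μ : Measure α} [IsFiniteMeasure μ]
    {g : α → ℝ} (hg : MemLp g 2 μ) : (∫ t, g t ∂μ) ^ 2 ≤ μ.real univ * ∫ t, g t ^ 2 ∂μ := by
  have h := real_inner_mul_inner_self_le
    (indicatorConstLp 2 MeasurableSet.univ (measure_ne_top μ _) (1 : ℝ)) (hg.toLp g)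
  rw [← sq, L2.inner_indicatorConstLp_one, L2.real_inner_indicatorConstLp_one_indicatorConstLp_one,
    Measure.restrict_univ, inter_univ, integral_congr_ae hg.coeFn_toLp, L2.inner_def] at h
  refine h.trans_eq (congrArg _ (integral_congr_ae ?_))
  filter_upwards [hg.coeFn_toLp] with t ht
  simp [ht, sq]

/-- Lebesgue measure on `[0,1]`. -/
abbrev unitVolume : Measure ℝ := volume.restrict (Icc 0 1)

/-- The space `L²([0,1])` of weak derivatives. -/
abbrev GradSpace : Type := Lp ℝ 2 unitVolume

/-- The indicator function of `(-∞, x]` in `L²([0,1])`: the functional that evaluates the primitive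
of an element of `L²([0,1])` at `x`. -/
def cutoff (x : ℝ) : GradSpace := indicatorConstLp 2 measurableSet_Iic (measure_ne_top _ (Iic x)) 1

/-- The functions in `L²([0,1])` with mean zero, that is the weak derivatives of the functions in
`H¹₀(0,1)`. -/
abbrev meanZero : Submodule ℝ GradSpace := (ℝ ∙ cutoff 1)ᗮ

/-- The function in `H¹₀(0,1)` with a given weak derivative. -/
def prim : meanZero →ₗ[ℝ] ℝ → ℝ where
  toFun g x := ⟪cutoff x, (g : GradSpace)⟫_ℝ
  map_add' _ _ := funext fun _ => inner_add_right _ _ _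
  map_smul' _ _ := funext fun _ => inner_smul_right _ _ _

theorem inner_cutoff (x : ℝ) (g : GradSpace) : ⟪cutoff x, g⟫_ℝ = ∫ t in Iic x, g t ∂unitVolume :=
  L2.inner_indicatorConstLp_one _ _ _

theorem inner_cutoff_of_le_one {x : ℝ} (hx : x ≤ 1) (g : GradSpace) :
    ⟪cutoff x, g⟫_ℝ = ∫ t in Icc 0 x, g t := by
  rw [inner_cutoff, Measure.restrict_restrict measurableSet_Iic]
  congr 2
  ext t
  simp only [mem_inter_iff, mem_Iic, mem_Icc]
  grind

theorem prim_apply (g : meanZero) (x : ℝ) : prim g x = ⟪cutoff x, (g : GradSpace)⟫_ℝ := rfl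

theorem prim_of_nonpos (g : meanZero) {x : ℝ} (hx : x ≤ 0) : prim g x = 0 := by
  rw [prim_apply, inner_cutoff_of_le_one (hx.trans zero_le_one)]
  exact setIntegral_measure_zero _ (by simp [hx])

theorem inner_cutoff_of_one_le {x : ℝ} (hx : 1 ≤ x) (g : GradSpace) :
    ⟪cutoff x, g⟫_ℝ = ∫ t, g t ∂unitVolume := by
  rw [inner_cutoff, Measure.restrict_restrict measurableSet_Iic,
    inter_eq_right.2 fun t ht => ht.2.trans hx]

theorem prim_of_one_le (g : meanZero) {x : ℝ} (hx : 1 ≤ x) : prim g x = 0 := by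
  rw [prim_apply, inner_cutoff_of_one_le hx, ← inner_cutoff_of_one_le le_rfl]
  exact Submodule.mem_orthogonal_singleton_iff_inner_right.1 g.2

theorem prim_of_notMem (g : meanZero) {x : ℝ} (hx : x ∉ Ioo (0 : ℝ) 1) : prim g x = 0 := by
  rcases le_or_gt x 0 with h | h
  · exact prim_of_nonpos g h
  · exact prim_of_one_le g (not_lt.1 fun h1 => hx ⟨h, h1⟩)

theorem integrable_gradSpace (g : GradSpace) : Integrable g unitVolume :=
  (Lp.memLp g).integrable one_le_two

theorem prim_sub_prim (g : meanZero) (a b : ℝ) :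
    prim g b - prim g a = ∫ t in a..b, (g : GradSpace) t ∂unitVolume := by
  rw [prim_apply, prim_apply, inner_cutoff, inner_cutoff]
  exact intervalIntegral.integral_Iic_sub_Iic (integrable_gradSpace g).integrableOn
    (integrable_gradSpace g).integrableOn

theorem continuous_prim (g : meanZero) : Continuous (prim g) := by
  have h : prim g = fun x => ∫ t in (0 : ℝ)..x, (g : GradSpace) t ∂unitVolume := by
    funext x
    rw [← prim_sub_prim, prim_of_nonpos g le_rfl, sub_zero]
  rw [h]
  exact intervalIntegral.continuous_primitive
    (fun _ _ => (integrable_gradSpace g).intervalIntegrable) 0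

theorem sq_prim_sub_prim_le (g : meanZero) {a b : ℝ} (hab : a ≤ b) :
    (prim g b - prim g a) ^ 2 ≤ (b - a) * ∫ t in Ioc a b, (g : GradSpace) t ^ 2 ∂unitVolume := by
  rw [prim_sub_prim, intervalIntegral.integral_of_le hab]
  refine (sq_integral_le ((Lp.memLp (g : GradSpace)).restrict _)).trans
    (mul_le_mul_of_nonneg_right ?_ (integral_nonneg fun t => sq_nonneg _))
  rw [measureReal_restrict_apply_univ, ← Real.volume_real_Ioc_of_le hab]
  exact ENNReal.toReal_mono (by simp) (Measure.restrict_apply_le _ _)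

theorem norm_cutoff_le (x : ℝ) : ‖cutoff x‖ ≤ 1 := by
  refine norm_indicatorConstLp_le.trans ?_
  rw [norm_one, one_mul]
  refine Real.rpow_le_one measureReal_nonneg ((measureReal_mono (subset_univ _)).trans ?_)
    (by positivity)
  simp

theorem norm_sq_eq_integral (g : GradSpace) : ‖g‖ ^ 2 = ∫ t, g t ^ 2 ∂unitVolume := by
  rw [← real_inner_self_eq_norm_sq, L2.inner_def]
  simp [sq]

theorem abs_prim_le (g : meanZero) (x : ℝ) : |prim g x| ≤ ‖g‖ :=
  (abs_real_inner_le_norm _ _).trans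
    (mul_le_of_le_one_left (norm_nonneg _) (norm_cutoff_le x))

theorem hasGrad_prim (g : meanZero) : HasGrad (prim g) (g : GradSpace) := by
  refine ⟨Lp.memLp _, fun x hx => ?_⟩
  rw [prim_of_nonpos g le_rfl, zero_add, prim_apply, inner_cutoff_of_le_one hx.2]

theorem HasGrad.ae_eq {f g h : ℝ → ℝ} (hg : HasGrad f g) (hh : HasGrad f h) :
    g =ᵐ[unitVolume] h :=
  ae_eq_of_forall_setIntegral_Icc_eq (hg.1.integrable one_le_two) (hh.1.integrable one_le_two)
    fun x hx => add_left_cancel ((hg.2 x hx).symm.trans (hh.2 x hx))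

theorem grad_prim (g : meanZero) : grad (prim g) =ᵐ[unitVolume] (g : GradSpace) := by
  have h : ∃ g', HasGrad (prim g) g' := ⟨_, hasGrad_prim g⟩
  rw [grad, dif_pos h]
  exact h.choose_spec.ae_eq (hasGrad_prim g)

theorem prim_injective : Function.Injective prim := fun g h hgh =>
  Subtype.ext (Lp.ext ((hasGrad_prim g).ae_eq (hgh ▸ hasGrad_prim h)))

theorem range_prim : range prim = H10 := by
  refine Subset.antisymm ?_ fun f ⟨⟨g, hgL, hg⟩, hf⟩ => ?_
  · rintro _ ⟨g, rfl⟩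
    exact ⟨⟨_, hasGrad_prim g⟩, fun x => prim_of_notMem g⟩
  have hinner : ∀ x ∈ Icc (0 : ℝ) 1, ⟪cutoff x, hgL.toLp g⟫_ℝ = f x := fun x hx => by
    rw [inner_cutoff_of_le_one hx.2, hg x hx, hf 0 (by simp), zero_add]
    exact integral_congr_ae (ae_restrict_of_ae_restrict_of_subset (Icc_subset_Icc_right hx.2)
      hgL.coeFn_toLp)
  have hmean : hgL.toLp g ∈ meanZero := by
    rw [Submodule.mem_orthogonal_singleton_iff_inner_right, hinner 1 (by simp), hf 1 (by simp)]
  refine ⟨⟨_, hmean⟩, funext fun x => ?_⟩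
  by_cases hx : x ∈ Ioo (0 : ℝ) 1
  · exact hinner x (Ioo_subset_Icc_self hx)
  · rw [prim_of_notMem _ hx, hf x hx]

theorem form_prim (g h : meanZero) : form (prim g) (prim h) = ⟪g, h⟫_ℝ := by
  rw [form, restrict_Ioo_eq_restrict_Icc, Submodule.coe_inner, L2.inner_def]
  refine integral_congr_ae ?_
  filter_upwards [grad_prim g, grad_prim h] with x hg hh
  simp [hg, hh, mul_comm]

/-! ### Functions that are affine on the gaps of the support -/

section Gaps

/-- `f` is affine on every interval in `[0,1]` whose interior does not meet the support of `ν`,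
endpoints included. -/
def IsGapAffine (ν : Measure ℝ) (f : ℝ → ℝ) : Prop :=
  ∀ ⦃a y b : ℝ⦄, 0 ≤ a → a ≤ y → y ≤ b → b ≤ 1 → Disjoint (Ioo a b) ν.support →
    (b - a) * f y = (y - a) * f b + (b - y) * f a

variable {ν : Measure ℝ} {f g : ℝ → ℝ}

theorem IsGapAffine.sub (hf : IsGapAffine ν f) (hg : IsGapAffine ν g) : IsGapAffine ν (f - g) :=
  fun a y b ha hay hyb hb hab => by
    simp only [Pi.sub_apply]
    linear_combination hf ha hay hyb hb hab - hg ha hay hyb hb hab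

theorem IsGapAffine.mem_Cnu (hf : IsGapAffine ν f) (hcont : ContinuousOn f (Icc 0 1)) :
    f ∈ Cnu ν := by
  refine ⟨hcont, fun x hx => ?_⟩
  set S := connectedComponentIn (Icc (0 : ℝ) 1 \ ν.support) x
  have hSsub : S ⊆ Icc (0 : ℝ) 1 \ ν.support := connectedComponentIn_subset _ _
  have hxS : x ∈ S := mem_connectedComponentIn hx
  have hord : S.OrdConnected := isPreconnected_connectedComponentIn.ordConnected
  have hbelow : BddBelow S := ⟨0, fun y hy => (hSsub hy).1.1⟩
  have habove : BddAbove S := ⟨1, fun y hy => (hSsub hy).1.2⟩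
  have hgap : Disjoint (Ioo (sInf S) (sSup S)) ν.support := disjoint_left.2 fun y hy => by
    obtain ⟨s, hs, hsy⟩ := exists_lt_of_csInf_lt ⟨x, hxS⟩ hy.1
    obtain ⟨s', hs', hys'⟩ := exists_lt_of_lt_csSup ⟨x, hxS⟩ hy.2
    exact (hSsub (hord.out hs hs' ⟨hsy.le, hys'.le⟩)).2
  have haff : ∀ y ∈ S, _ := fun y hy =>
    hf (le_csInf ⟨x, hxS⟩ fun z hz => (hSsub hz).1.1) (csInf_le hbelow hy) (le_csSup habove hy)
      (csSup_le ⟨x, hxS⟩ fun z hz => (hSsub hz).1.2) hgap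
  set a := sInf S
  set b := sSup S
  rcases ((csInf_le hbelow hxS).trans (le_csSup habove hxS) : a ≤ b).eq_or_lt with hab | hab
  · refine ⟨0, f a, fun y hy => ?_⟩
    rw [le_antisymm ((le_csSup habove hy).trans hab.ge) (csInf_le hbelow hy)]
    ring
  · have hne : b - a ≠ 0 := sub_ne_zero.2 hab.ne'
    refine ⟨(f b - f a) / (b - a), (b * f a - a * f b) / (b - a), fun y hy => ?_⟩
    field_simp
    linear_combination haff y hy

theorem isGapAffine_of_mem_Cnu (hf : f ∈ Cnu ν) : IsGapAffine ν f := by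
  intro a y b ha hay hyb hb hgap
  rcases (hay.trans hyb).eq_or_lt with rfl | hab
  · rw [le_antisymm hyb hay]
    ring
  have hsub : Ioo a b ⊆ Icc (0 : ℝ) 1 \ ν.support := fun z hz =>
    ⟨⟨ha.trans hz.1.le, hz.2.le.trans hb⟩, disjoint_left.1 hgap hz⟩
  obtain ⟨m, hm⟩ := nonempty_Ioo.2 hab
  obtain ⟨c, d, hcd⟩ := hf.2 m (hsub hm)
  have hopen : EqOn f (fun z => c * z + d) (Ioo a b) := fun z hz =>
    hcd z (isPreconnected_Ioo.subset_connectedComponentIn hm hsub hz)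
  have hclosed : EqOn f (fun z => c * z + d) (Icc a b) :=
    hopen.of_subset_closure (hf.1.mono (Icc_subset_Icc ha hb)) (by fun_prop) Ioo_subset_Icc_self
      (closure_Ioo hab.ne).ge
  rw [hclosed ⟨hay, hyb⟩, hclosed (left_mem_Icc.2 hab.le), hclosed (right_mem_Icc.2 hab.le)]
  ring

theorem exists_gap_of_isClosed {S : Set ℝ} (hS : IsClosed S) {l u x : ℝ} (hx : x ∈ Ioo l u)
    (hxS : x ∉ S) : ∃ a ∈ insert l S, ∃ b ∈ insert u S,
      l ≤ a ∧ a < x ∧ x < b ∧ b ≤ u ∧ Disjoint (Ioo a b) S := by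
  obtain ⟨a, ⟨haS, hla, hax⟩, ha⟩ := (isCompact_Icc.inter_left (hS.union isClosed_singleton)
    ).exists_isGreatest (s := (S ∪ {l}) ∩ Icc l x) ⟨l, .inr rfl, le_rfl, hx.1.le⟩
  obtain ⟨b, ⟨hbS, hxb, hbu⟩, hb⟩ := (isCompact_Icc.inter_left (hS.union isClosed_singleton)
    ).exists_isLeast (s := (S ∪ {u}) ∩ Icc x u) ⟨u, .inr rfl, hx.2.le, le_rfl⟩
  have hne : ∀ {z w}, z ∈ S ∪ {w} → w ≠ x → z ≠ x := by
    rintro z w (hz | rfl) hw rfl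
    exacts [hxS hz, hw rfl]
  refine ⟨a, by simpa [or_comm] using haS, b, by simpa [or_comm] using hbS, hla,
    hax.lt_of_ne (hne haS hx.1.ne), hxb.lt_of_ne' (hne hbS hx.2.ne'), hbu,
    disjoint_left.2 fun y hy hyS => ?_⟩
  rcases le_total y x with h | h
  · exact (hy.1.trans_le (ha ⟨.inl hyS, hla.trans hy.1.le, h⟩)).false
  · exact ((hb ⟨.inl hyS, h, hy.2.le.trans hbu⟩).trans_lt hy.2).false

theorem IsGapAffine.eq_zero (hf : IsGapAffine ν f) (hIoo : ∀ x ∉ Ioo (0 : ℝ) 1, f x = 0)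
    (hsupport : ∀ x ∈ ν.support, f x = 0) : f = 0 := by
  funext x
  by_cases hx : x ∈ Ioo (0 : ℝ) 1
  swap
  · exact hIoo x hx
  by_cases hxν : x ∈ ν.support
  · exact hsupport x hxν
  obtain ⟨a, ha, b, hb, ha0, hax, hxb, hb1, hgap⟩ :=
    exists_gap_of_isClosed Measure.isClosed_support hx hxν
  have hfa : f a = 0 := ha.elim (fun h => hIoo a (by simp [h])) (hsupport a)
  have hfb : f b = 0 := hb.elim (fun h => hIoo b (by simp [h])) (hsupport b)
  have h := hf ha0 hax.le hxb.le hb1 hgap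
  rw [hfa, hfb, mul_zero, mul_zero, add_zero] at h
  exact (mul_eq_zero.1 h).resolve_left (sub_ne_zero.2 (hax.trans hxb).ne')

end Gaps

/-! ### The mass embedding -/

section MassEmbedding

variable (ν : Measure ℝ) [IsFiniteMeasure ν]

theorem memLp_prim (g : meanZero) : MemLp (prim g) 2 ν :=
  .of_bound (continuous_prim g).aestronglyMeasurable ‖g‖ (.of_forall (abs_prim_le g))

/-- The embedding of `H¹₀(0,1)`, identified with `meanZero`, into `L²(ν)`. -/
def massEmbedding : meanZero →L[ℝ] Lp ℝ 2 ν :=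
  LinearMap.mkContinuous
    { toFun := fun g => (memLp_prim ν g).toLp (prim g)
      map_add' := fun g h => by simp only [map_add]; exact MemLp.toLp_add _ _
      map_smul' := fun c g => by simp only [map_smul]; exact MemLp.toLp_const_smul _ _ }
    (ν.real univ ^ (2 : ℝ≥0∞).toReal⁻¹) fun g => by
      refine Lp.norm_le_of_ae_bound (norm_nonneg g) ?_
      filter_upwards [(memLp_prim ν g).coeFn_toLp] with t ht
      exact ht ▸ abs_prim_le g t

/-- The operator of the form `(g, h) ↦ ∫ (prim g) (prim h) dν` on `meanZero`, that is the inverse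
of the Kreĭn–Feller operator. -/
def massOp : meanZero →L[ℝ] meanZero := (massEmbedding ν).adjoint ∘L massEmbedding ν

theorem massEmbedding_ae_eq (g : meanZero) : massEmbedding ν g =ᵐ[ν] prim g :=
  (memLp_prim ν g).coeFn_toLp

theorem inner_massEmbedding (g h : meanZero) :
    ⟪massEmbedding ν g, massEmbedding ν h⟫_ℝ = ∫ t, prim g t * prim h t ∂ν := by
  rw [L2.inner_def]
  refine integral_congr_ae ?_
  filter_upwards [massEmbedding_ae_eq ν g, massEmbedding_ae_eq ν h] with t hg hh
  simp [hg, hh, mul_comm]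

theorem inner_massOp (g h : meanZero) :
    ⟪massOp ν g, h⟫_ℝ = ∫ t, prim g t * prim h t ∂ν := by
  rw [← inner_massEmbedding, massOp, ContinuousLinearMap.comp_apply,
    ContinuousLinearMap.adjoint_inner_left]

theorem inner_massOp_self (g : meanZero) : ⟪massOp ν g, g⟫_ℝ = ∫ t, prim g t ^ 2 ∂ν := by
  simp only [inner_massOp, sq]

theorem isPositive_massOp : (massOp ν).IsPositive :=
  ContinuousLinearMap.isPositive_adjoint_comp_self (massEmbedding ν)

variable {ν}

theorem mem_ker_massEmbedding {g : meanZero} :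
    g ∈ (massEmbedding ν).ker ↔ ∀ x ∈ ν.support, prim g x = 0 := by
  have hker : g ∈ (massEmbedding ν).ker ↔ prim g =ᵐ[ν] 0 := by
    rw [LinearMap.mem_ker]
    exact Lp.eq_zero_iff_ae_eq_zero.trans
      ⟨(massEmbedding_ae_eq ν g).symm.trans, (massEmbedding_ae_eq ν g).trans⟩
  rw [hker]
  refine ⟨fun h => Measure.support_subset_of_isClosed
    (isClosed_eq (continuous_prim g) continuous_const) h, fun h => ?_⟩
  filter_upwards [Measure.support_mem_ae] with x hx using h x hx

theorem inner_cutoff_cutoff {x y : ℝ} (hx : x ∈ Icc (0 : ℝ) 1) (hy : y ∈ Icc (0 : ℝ) 1) :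
    ⟪cutoff x, cutoff y⟫_ℝ = min x y := by
  have h : Iic x ∩ Iic y ∩ Icc (0 : ℝ) 1 = Icc 0 (min x y) := by
    ext t
    simp only [mem_inter_iff, mem_Iic, mem_Icc, le_min_iff]
    grind
  rw [cutoff, cutoff, L2.real_inner_indicatorConstLp_one_indicatorConstLp_one,
    measureReal_restrict_apply (measurableSet_Iic.inter measurableSet_Iic), h,
    Real.volume_real_Icc_of_le (le_min hx.1 hy.1), sub_zero]

theorem isGapAffine_prim {g : meanZero} (hg : g ∈ (massEmbedding ν).kerᗮ) :
    IsGapAffine ν (prim g) := by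
  intro a y b ha hay hyb hb hgap
  have haI : a ∈ Icc (0 : ℝ) 1 := ⟨ha, (hay.trans hyb).trans hb⟩
  have hbI : b ∈ Icc (0 : ℝ) 1 := ⟨(ha.trans hay).trans hyb, hb⟩
  have hyI : y ∈ Icc (0 : ℝ) 1 := ⟨ha.trans hay, hyb.trans hb⟩
  -- The derivative of the tent function with nodes `a`, `y`, `b`.
  set k : GradSpace := (b - a) • cutoff y - (y - a) • cutoff b - (b - y) • cutoff a with hk
  have hkx : ∀ x ∈ Icc (0 : ℝ) 1, x ∉ Ioo a b → ⟪cutoff x, k⟫_ℝ = 0 := fun x hx hxab => by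
    simp only [hk, inner_sub_right, inner_smul_right, inner_cutoff_cutoff hx hyI,
      inner_cutoff_cutoff hx hbI, inner_cutoff_cutoff hx haI]
    rcases le_or_gt x a with h | h
    · rw [min_eq_left h, min_eq_left (h.trans hay), min_eq_left ((h.trans hay).trans hyb)]
      ring
    · have h' : b ≤ x := not_lt.1 fun h' => hxab ⟨h, h'⟩
      rw [min_eq_right h', min_eq_right (hyb.trans h'), min_eq_right h.le]
      ring
  have hkmean : k ∈ meanZero := Submodule.mem_orthogonal_singleton_iff_inner_right.2
    (hkx 1 (by simp) fun h => (h.2.trans_le hb).false)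
  have hkker : (⟨k, hkmean⟩ : meanZero) ∈ (massEmbedding ν).ker :=
    mem_ker_massEmbedding.2 fun x hx => by
      by_cases hx1 : x ∈ Ioo (0 : ℝ) 1
      · exact hkx x (Ioo_subset_Icc_self hx1) fun h => disjoint_left.1 hgap h hx
      · exact prim_of_notMem _ hx1
  have horth : ⟪k, (g : GradSpace)⟫_ℝ = 0 := hg _ hkker
  simp only [hk, inner_sub_left, real_inner_smul_left, ← prim_apply] at horth
  linear_combination horth

variable (ν) in
theorem dom_eq_image_prim : dom ν = prim '' ((massEmbedding ν).kerᗮ : Submodule ℝ meanZero) := by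
  rw [dom, ← range_prim]
  refine Subset.antisymm ?_ ?_
  · rintro _ ⟨⟨g, rfl⟩, hg⟩
    obtain ⟨k, hk, u, hu, rfl⟩ := (massEmbedding ν).ker.exists_add_mem_mem_orthogonal g
    refine ⟨_, ?_, rfl⟩
    have hkaff : IsGapAffine ν (prim k) := by
      simpa using (isGapAffine_of_mem_Cnu hg).sub (isGapAffine_prim hu)
    have hk0 : k = 0 := prim_injective (by
      rw [hkaff.eq_zero (fun x => prim_of_notMem k) (mem_ker_massEmbedding.1 hk), map_zero])
    rwa [hk0, zero_add]
  · rintro _ ⟨g, hg, rfl⟩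
    exact ⟨mem_range_self g, (isGapAffine_prim hg).mem_Cnu (continuous_prim g).continuousOn⟩

theorem massOp_mem_orthogonal_ker (g : meanZero) : massOp ν g ∈ (massEmbedding ν).kerᗮ :=
  fun k hk => by
    have hk0 : massEmbedding ν k = 0 := hk
    rw [real_inner_comm, massOp, ContinuousLinearMap.comp_apply,
      ContinuousLinearMap.adjoint_inner_left, hk0, inner_zero_right]

theorem isEigenfunction_iff {l : ℝ} {f : ℝ → ℝ} :
    IsEigenfunction ν l f ↔ ∃ g ≠ 0, l • massOp ν g = g ∧ prim g = f := by
  rw [IsEigenfunction, dom_eq_image_prim]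
  constructor
  · rintro ⟨⟨g, hg, rfl⟩, hg0, heig⟩
    refine ⟨g, fun h => hg0 (by rw [h, map_zero]), ?_, rfl⟩
    have hmem : g - l • massOp ν g ∈ (massEmbedding ν).kerᗮ :=
      Submodule.sub_mem _ hg (Submodule.smul_mem _ _ (massOp_mem_orthogonal_ker g))
    have hself : ⟪g - l • massOp ν g, g - l • massOp ν g⟫_ℝ = 0 := by
      have h := heig _ (mem_image_of_mem prim hmem)
      rwa [form_prim, ← inner_massOp, ← real_inner_smul_left, ← sub_eq_zero, ← inner_sub_left] at h
    exact (sub_eq_zero.1 (inner_self_eq_zero.1 hself)).symm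
  · rintro ⟨g, hg0, hg, rfl⟩
    refine ⟨⟨g, hg ▸ Submodule.smul_mem _ _ (massOp_mem_orthogonal_ker g), rfl⟩, ?_, ?_⟩
    · rwa [ne_eq, ← map_zero prim, prim_injective.eq_iff]
    · rintro _ ⟨h, -, rfl⟩
      rw [form_prim, ← inner_massOp, ← real_inner_smul_left, hg]

theorem pos_of_smul_massOp_eq {l : ℝ} {g : meanZero} (hg0 : g ≠ 0) (hg : l • massOp ν g = g) :
    0 < l := by
  have h : l * ⟪massOp ν g, g⟫_ℝ = ‖g‖ ^ 2 := by
    rw [← real_inner_smul_left, hg, real_inner_self_eq_norm_sq]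
  exact pos_of_mul_pos_left (h ▸ by positivity) ((isPositive_massOp ν).re_inner_nonneg_left g)

theorem span_eigenfunctions (x : ℝ) :
    Submodule.span ℝ {f | ∃ l ≤ x, IsEigenfunction ν l f} = (lowSpace (massOp ν) x).map prim := by
  refine le_antisymm (Submodule.span_le.2 ?_) ?_
  · rintro f ⟨l, hlx, hf⟩
    obtain ⟨g, hg0, hg, rfl⟩ := isEigenfunction_iff.1 hf
    have hl := pos_of_smul_massOp_eq hg0 hg
    exact Submodule.mem_map_of_mem (mem_lowSpace ⟨hl, hlx⟩ ((eq_inv_smul_iff₀ hl.ne').2 hg))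
  · rw [lowSpace, Submodule.map_iSup]
    refine iSup_le fun ⟨l, hl⟩ => ?_
    rintro _ ⟨g, hg, rfl⟩
    rcases eq_or_ne g 0 with rfl | hg0
    · rw [map_zero]
      exact zero_mem _
    · exact Submodule.subset_span ⟨l, hl.2, isEigenfunction_iff.2 ⟨g, hg0,
        (eq_inv_smul_iff₀ hl.1.ne').1 (Module.End.mem_eigenspace_iff.1 hg), rfl⟩⟩

theorem eigenCount_eq (x : ℝ) :
    eigenCount ν x = Cardinal.toENat (Module.rank ℝ (lowSpace (massOp ν) x)) := by
  rw [eigenCount, span_eigenfunctions,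
    (Submodule.equivMapOfInjective prim prim_injective _).symm.rank_eq]

end MassEmbedding

/-! ### Upper bound of the counting function by dyadic intervals -/

section Dyadic

theorem two_mul_div_two_pow_succ (n k : ℕ) : ((2 * k : ℕ) : ℝ) / 2 ^ (n + 1) = k / 2 ^ n := by
  push_cast
  rw [pow_succ']
  exact mul_div_mul_left _ _ two_ne_zero

theorem dyadic_succ (n k : ℕ) :
    dyadic n k = dyadic (n + 1) (2 * k) ∪ dyadic (n + 1) (2 * k + 1) := by
  have hright : (((2 * k + 1 : ℕ) : ℝ) + 1) / 2 ^ (n + 1) = ((k : ℝ) + 1) / 2 ^ n := by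
    rw [← Nat.cast_add_one, ← Nat.cast_add_one, ← two_mul_div_two_pow_succ n (k + 1), mul_add_one]
  rw [dyadic, dyadic, dyadic, two_mul_div_two_pow_succ, hright, Nat.cast_succ, Ioc_union_Ioc_eq_Ioc]
  · rw [← two_mul_div_two_pow_succ]
    gcongr
    exact (lt_add_one _).le
  · rw [← hright, Nat.cast_succ]
    gcongr
    exact (lt_add_one _).le

theorem disjoint_dyadic {n k l : ℕ} (h : k ≠ l) : Disjoint (dyadic n k) (dyadic n l) := by
  wlog hkl : k < l generalizing k l
  · exact (this h.symm (h.symm.lt_of_le (not_lt.1 hkl))).symm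
  refine Ioc_disjoint_Ioc_of_le ?_
  gcongr
  exact_mod_cast hkl

theorem setIntegral_dyadic_succ {μ : Measure ℝ} {f : ℝ → ℝ} (hf : Integrable f μ) (n k : ℕ) :
    ∫ x in dyadic n k, f x ∂μ =
      ∫ x in dyadic (n + 1) (2 * k), f x ∂μ + ∫ x in dyadic (n + 1) (2 * k + 1), f x ∂μ := by
  rw [dyadic_succ, setIntegral_union (disjoint_dyadic (by lia)) measurableSet_Ioc
    hf.integrableOn hf.integrableOn]

open Classical in
/-- The indices `(n, k)` with `n < N` of the dyadic intervals `C` with `ν(C) |C| ≥ t`. -/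
def heavy (ν : Measure ℝ) (t : ℝ) (N : ℕ) : Finset (Σ _ : ℕ, ℕ) :=
  (Finset.range N).sigma fun n =>
    (Finset.range (2 ^ n)).filter fun k => t ≤ ν.real (dyadic n k) / 2 ^ n

/-- The midpoint of the dyadic interval with index `p`. -/
def midpt (p : Σ _ : ℕ, ℕ) : ℝ := ((2 * p.2 + 1 : ℕ) : ℝ) / 2 ^ (p.1 + 1)

/-- The element of `meanZero` that represents the evaluation `g ↦ prim g x`. -/
def evalVec (x : ℝ) : meanZero := meanZero.orthogonalProjectionOnto (cutoff x)

theorem inner_evalVec (x : ℝ) (g : meanZero) : ⟪evalVec x, g⟫_ℝ = prim g x :=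
  Submodule.inner_orthogonalProjectionOnto_eq_of_mem_right g (cutoff x)

/-- The span of the evaluations at the midpoints of the heavy dyadic intervals. -/
def heavySpan (ν : Measure ℝ) (t : ℝ) (N : ℕ) : Submodule ℝ meanZero :=
  Submodule.span ℝ ((fun p => evalVec (midpt p)) '' heavy ν t N)

variable {ν : Measure ℝ} {g : meanZero} {t : ℝ} {N : ℕ}

instance : FiniteDimensional ℝ (heavySpan ν t N) :=
  FiniteDimensional.span_of_finite ℝ ((heavy ν t N).finite_toSet.image _)

theorem rank_heavySpan_le : Module.rank ℝ (heavySpan ν t N) ≤ (heavy ν t N).card :=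
  (rank_span_le _).trans (Cardinal.mk_image_le.trans_eq (by simp))

theorem prim_midpt_eq_zero (hg : g ∈ (heavySpan ν t N)ᗮ) {p : Σ _ : ℕ, ℕ} (hp : p ∈ heavy ν t N) :
    prim g (midpt p) = 0 := by
  rw [← inner_evalVec]
  exact hg _ (Submodule.subset_span (mem_image_of_mem _ hp))

variable [IsFiniteMeasure ν]

theorem integrable_prim_sq (g : meanZero) : Integrable (fun x => prim g x ^ 2) ν :=
  (memLp_prim ν g).integrable_sq

theorem integrable_gradSpace_sq (g : GradSpace) : Integrable (fun t => g t ^ 2) unitVolume :=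
  (Lp.memLp g).integrable_sq

theorem setIntegral_prim_sq_le {a b : ℝ} (hab : a ≤ b) (hga : prim g a = 0) :
    ∫ x in Ioc a b, prim g x ^ 2 ∂ν ≤
      ν.real (Ioc a b) * (b - a) * ∫ t in Ioc a b, (g : GradSpace) t ^ 2 ∂unitVolume := by
  have hpt : ∀ x ∈ Ioc a b,
      prim g x ^ 2 ≤ (b - a) * ∫ t in Ioc a b, (g : GradSpace) t ^ 2 ∂unitVolume := fun x hx => by
    have h := sq_prim_sub_prim_le g hx.1.le
    rw [hga, sub_zero] at h
    refine h.trans (mul_le_mul (sub_le_sub_right hx.2 a) ?_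
      (integral_nonneg fun t => sq_nonneg _) (sub_nonneg.2 hab))
    exact setIntegral_mono_set (integrable_gradSpace_sq g).integrableOn
      (.of_forall fun t => sq_nonneg _) (Ioc_subset_Ioc_right hx.2).eventuallyLE
  refine (setIntegral_mono_on (integrable_prim_sq g).integrableOn (integrable_const _)
    measurableSet_Ioc hpt).trans_eq ?_
  rw [setIntegral_const, smul_eq_mul, mul_assoc]

theorem setIntegral_dyadic_prim_sq_le_of_light {n k : ℕ} (hlight : ν.real (dyadic n k) / 2 ^ n ≤ t)
    (h0 : prim g (k / 2 ^ n) = 0) :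
    ∫ x in dyadic n k, prim g x ^ 2 ∂ν ≤
      t * ∫ x in dyadic n k, (g : GradSpace) x ^ 2 ∂unitVolume := by
  refine (setIntegral_prim_sq_le (by gcongr; linarith) h0).trans
    (mul_le_mul_of_nonneg_right ?_ (integral_nonneg fun t => sq_nonneg _))
  rwa [← sub_div, add_sub_cancel_left, mul_one_div]

-- Bisect `dyadic n k` as long as it is heavy: `prim g` vanishes at the left end points of all the
-- intervals that occur.
theorem setIntegral_dyadic_prim_sq_le (hN : ν.real univ / 2 ^ N ≤ t)
    (hg : g ∈ (heavySpan ν t N)ᗮ) {n k : ℕ} (hn : n ≤ N) (hk : k < 2 ^ n)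
    (h0 : prim g (k / 2 ^ n) = 0) :
    ∫ x in dyadic n k, prim g x ^ 2 ∂ν ≤
      t * ∫ x in dyadic n k, (g : GradSpace) x ^ 2 ∂unitVolume := by
  induction hn using Nat.decreasingInduction generalizing k with
  | self =>
    refine setIntegral_dyadic_prim_sq_le_of_light (le_trans ?_ hN) h0
    gcongr
    exacts [measure_ne_top _ _, subset_univ _]
  | of_succ n hn ih =>
    rcases le_total (ν.real (dyadic n k) / 2 ^ n) t with hlight | hheavy
    · exact setIntegral_dyadic_prim_sq_le_of_light hlight h0
    have hmem : (⟨n, k⟩ : Σ _ : ℕ, ℕ) ∈ heavy ν t N := by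
      simp only [heavy, Finset.mem_sigma, Finset.mem_filter, Finset.mem_range]
      exact ⟨hn, hk, hheavy⟩
    rw [setIntegral_dyadic_succ (integrable_prim_sq g),
      setIntegral_dyadic_succ (integrable_gradSpace_sq g), mul_add]
    have hk' : 2 * k + 1 < 2 ^ (n + 1) := by rw [pow_succ]; lia
    refine add_le_add (ih (by lia) (by rwa [two_mul_div_two_pow_succ])) (ih hk' ?_)
    rw [← prim_midpt_eq_zero hg hmem, midpt]

theorem integral_prim_sq_le (hN : ν.real univ / 2 ^ N ≤ t) (hg : g ∈ (heavySpan ν t N)ᗮ) :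
    ∫ x, prim g x ^ 2 ∂ν ≤ t * ‖g‖ ^ 2 := by
  have h := setIntegral_dyadic_prim_sq_le hN hg N.zero_le one_pos
    (by rw [Nat.cast_zero, zero_div, prim_of_nonpos g le_rfl])
  have hunit : dyadic 0 0 = Ioc 0 1 := by simp [dyadic]
  rw [hunit, Measure.restrict_restrict_of_subset Ioc_subset_Icc_self,
    ← integral_Icc_eq_integral_Ioc (μ := volume), ← norm_sq_eq_integral,
    setIntegral_eq_integral_of_forall_compl_eq_zero] at h
  · exact h
  · intro x hx
    rw [prim_of_notMem g fun h => hx (Ioo_subset_Ioc_self h), sq, zero_mul]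

variable (ν) in
theorem isCompactOperator_massOp : IsCompactOperator (massOp ν) := by
  refine IsCompactOperator.clm_comp (isCompactOperator_of_small_on_orthogonal (𝕜 := ℝ)
    fun ε hε => ?_) (massEmbedding ν).adjoint
  obtain ⟨N, hN⟩ := ((tendsto_const_nhds.div_atTop (tendsto_pow_atTop_atTop_of_one_lt one_lt_two)
    ).eventually_le_const (sq_pos_of_pos hε)).exists
  refine ⟨heavySpan ν (ε ^ 2) N, inferInstance, fun u hu => ?_⟩
  refine le_of_sq_le_sq ?_ (by positivity)
  rw [mul_pow, ← real_inner_self_eq_norm_sq, inner_massEmbedding]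
  simpa only [sq] using integral_prim_sq_le hN hu

theorem eigenCount_le_card_heavy {x : ℝ} (hx : 0 ≤ x) (hxt : x * t < 1)
    (hN : ν.real univ / 2 ^ N ≤ t) : eigenCount ν x ≤ (heavy ν t N).card := by
  rw [eigenCount_eq, Cardinal.toENat_le_natCast]
  refine (rank_lowSpace_le (isPositive_massOp ν).isSymmetric fun v hv hv0 => ?_).trans
    rank_heavySpan_le
  have hv2 : 0 < ‖v‖ ^ 2 := by positivity
  rw [RCLike.re_to_real, inner_massOp_self]
  calc x * ∫ y, prim v y ^ 2 ∂ν ≤ x * (t * ‖v‖ ^ 2) := by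
        gcongr
        exact integral_prim_sq_le hN hv
    _ = x * t * ‖v‖ ^ 2 := (mul_assoc _ _ _).symm
    _ < ‖v‖ ^ 2 := mul_lt_of_lt_one_left hv2 hxt

end Dyadic

/-! ### Lower bound of the counting function by plateau functions -/

section Families

theorem norm_sq_sum_of_pairwise_inner_eq_zero {𝕜 E ι : Type*} [RCLike 𝕜] [NormedAddCommGroup E]
    [InnerProductSpace 𝕜 E] [Fintype ι] {v : ι → E} (h : Pairwise fun i j => ⟪v i, v j⟫_𝕜 = 0) :
    ‖∑ i, v i‖ ^ 2 = ∑ i, ‖v i‖ ^ 2 := by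
  rw [norm_sq_eq_re_inner (𝕜 := 𝕜), sum_inner, map_sum]
  refine Finset.sum_congr rfl fun i _ => ?_
  rw [inner_sum, Finset.sum_eq_single_of_mem i (Finset.mem_univ i) fun j _ hj => h hj.symm,
    norm_sq_eq_re_inner (𝕜 := 𝕜)]

variable {ν : Measure ℝ} [IsFiniteMeasure ν]

theorem inner_massOp_self_eq_norm_sq (g : meanZero) :
    ⟪massOp ν g, g⟫_ℝ = ‖massEmbedding ν g‖ ^ 2 := by
  rw [inner_massOp, ← inner_massEmbedding, real_inner_self_eq_norm_sq]

theorem card_le_eigenCount {ι : Type*} [Fintype ι] {g : ι → meanZero} {x : ℝ} (hne : ∀ i, g i ≠ 0)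
    (horth : Pairwise fun i j => ⟪g i, g j⟫_ℝ = 0)
    (hmass : Pairwise fun i j => ⟪massEmbedding ν (g i), massEmbedding ν (g j)⟫_ℝ = 0)
    (hle : ∀ i, ‖g i‖ ^ 2 ≤ x * ∫ y, prim (g i) y ^ 2 ∂ν) :
    (Fintype.card ι : ℕ∞) ≤ eigenCount ν x := by
  have hindep : LinearIndependent ℝ g := linearIndependent_of_ne_zero_of_inner_eq_zero hne horth
  have := FiniteDimensional.span_of_finite ℝ (finite_range g)
  have hrank : Module.rank ℝ (Submodule.span ℝ (range g)) = Fintype.card ι := by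
    rw [← Module.finrank_eq_rank, finrank_span_eq_card hindep]
  have hspan : ∀ v ∈ Submodule.span ℝ (range g), ‖v‖ ^ 2 ≤ x * ⟪massOp ν v, v⟫_ℝ := fun v hv => by
    obtain ⟨c, rfl⟩ := (Submodule.mem_span_range_iff_exists_fun ℝ).1 hv
    rw [inner_massOp_self_eq_norm_sq, map_sum,
      norm_sq_sum_of_pairwise_inner_eq_zero (𝕜 := ℝ) fun i j hij => by
        simp only [real_inner_smul_left, real_inner_smul_right, horth hij, mul_zero],
      norm_sq_sum_of_pairwise_inner_eq_zero (𝕜 := ℝ) fun i j hij => by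
        simp only [map_smul, real_inner_smul_left, real_inner_smul_right, hmass hij, mul_zero],
      Finset.mul_sum]
    refine Finset.sum_le_sum fun i _ => ?_
    have h := hle i
    rw [← inner_massOp_self, inner_massOp_self_eq_norm_sq] at h
    rw [map_smul, norm_smul, norm_smul, mul_pow, mul_pow, mul_left_comm]
    gcongr
  rw [eigenCount_eq, Cardinal.natCast_le_toENat, ← hrank]
  exact rank_le_rank_lowSpace (isCompactOperator_massOp ν) (isPositive_massOp ν) hspan

end Families

section Plateau

theorem prim_evalVec {x y : ℝ} (hx : x ∈ Icc (0 : ℝ) 1) (hy : y ∈ Icc (0 : ℝ) 1) :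
    prim (evalVec y) x = min x y - x * y := by
  have h1 : (1 : ℝ) ∈ Icc (0 : ℝ) 1 := ⟨zero_le_one, le_rfl⟩
  have hnorm : ‖cutoff 1‖ = 1 := by
    rw [← sq_eq_sq₀ (norm_nonneg _) zero_le_one, ← real_inner_self_eq_norm_sq,
      inner_cutoff_cutoff h1 h1, min_self, one_pow]
  have hproj : (evalVec y : GradSpace) = cutoff y - ⟪cutoff 1, cutoff y⟫_ℝ • cutoff 1 := by
    rw [evalVec, ← Submodule.starProjection_apply, Submodule.starProjection_orthogonal_val,
      Submodule.starProjection_unit_singleton ℝ hnorm]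
  rw [prim_apply, hproj, inner_sub_right, inner_smul_right,
    inner_cutoff_cutoff hx hy, inner_cutoff_cutoff hx h1, inner_cutoff_cutoff h1 hy,
    min_eq_left hx.2, min_eq_right hy.2, mul_comm y]

/-- The derivative of the plateau function that is `1` on `[a, b]`, vanishes outside
`(a - δ, b + δ)` and is affine in between, for `0 ≤ a - δ ≤ a ≤ b ≤ b + δ ≤ 1`. -/
def plateau (δ a b : ℝ) : meanZero :=
  δ⁻¹ • (evalVec a - evalVec (a - δ) - evalVec (b + δ) + evalVec b)

variable {δ a b x : ℝ}

theorem inner_plateau (g : meanZero) : ⟪plateau δ a b, g⟫_ℝ =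
    δ⁻¹ * (prim g a - prim g (a - δ) - prim g (b + δ) + prim g b) := by
  rw [plateau, real_inner_smul_left, inner_add_left, inner_sub_left, inner_sub_left, inner_evalVec,
    inner_evalVec, inner_evalVec, inner_evalVec]

theorem prim_plateau (hδ : 0 < δ) (ha : 0 ≤ a - δ) (hab : a ≤ b) (hb : b + δ ≤ 1) (x : ℝ) :
    prim (plateau δ a b) x =
    δ⁻¹ * (min x a - min x (a - δ) - min x (b + δ) + min x b) := by
  rcases le_or_gt x 0 with h0 | h0
  · rw [prim_of_nonpos _ h0, min_eq_left, min_eq_left, min_eq_left, min_eq_left] <;> linarith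
  rcases le_or_gt 1 x with h1 | h1
  · rw [prim_of_one_le _ h1, min_eq_right, min_eq_right, min_eq_right, min_eq_right] <;> linarith
  have hx : x ∈ Icc (0 : ℝ) 1 := ⟨h0.le, h1.le⟩
  simp only [plateau, map_smul, map_add, map_sub, Pi.smul_apply, Pi.add_apply, Pi.sub_apply,
    smul_eq_mul]
  rw [prim_evalVec hx ⟨by linarith, by linarith⟩, prim_evalVec hx ⟨by linarith, by linarith⟩,
    prim_evalVec hx ⟨by linarith, by linarith⟩, prim_evalVec hx ⟨by linarith, by linarith⟩]
  ring

theorem prim_plateau_of_notMem (hδ : 0 < δ) (ha : 0 ≤ a - δ) (hab : a ≤ b) (hb : b + δ ≤ 1)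
    (hx : x ∉ Ioo (a - δ) (b + δ)) : prim (plateau δ a b) x = 0 := by
  rw [prim_plateau hδ ha hab hb]
  rcases le_or_gt x (a - δ) with h | h
  · rw [min_eq_left, min_eq_left, min_eq_left, min_eq_left] <;> linarith
  · have h' : b + δ ≤ x := not_lt.1 fun h' => hx ⟨h, h'⟩
    rw [min_eq_right, min_eq_right, min_eq_right, min_eq_right] <;> linarith

theorem prim_plateau_of_mem (hδ : 0 < δ) (ha : 0 ≤ a - δ) (hab : a ≤ b) (hb : b + δ ≤ 1)
    (hx : x ∈ Icc a b) : prim (plateau δ a b) x = 1 := by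
  rw [prim_plateau hδ ha hab hb, min_eq_right hx.1, min_eq_right (by linarith [hx.1]),
    min_eq_left (by linarith [hx.2]), min_eq_left hx.2]
  field_simp
  ring

theorem norm_sq_plateau (hδ : 0 < δ) (ha : 0 ≤ a - δ) (hab : a ≤ b) (hb : b + δ ≤ 1) :
    ‖plateau δ a b‖ ^ 2 = 2 / δ := by
  rw [← real_inner_self_eq_norm_sq, inner_plateau,
    prim_plateau_of_mem hδ ha hab hb (left_mem_Icc.2 hab),
    prim_plateau_of_mem hδ ha hab hb (right_mem_Icc.2 hab),
    prim_plateau_of_notMem hδ ha hab hb left_notMem_Ioo,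
    prim_plateau_of_notMem hδ ha hab hb right_notMem_Ioo]
  ring

theorem measureReal_le_integral_prim_plateau_sq (hδ : 0 < δ) (ha : 0 ≤ a - δ) (hab : a ≤ b)
    (hb : b + δ ≤ 1) {ν : Measure ℝ} [IsFiniteMeasure ν] :
    ν.real (Icc a b) ≤ ∫ y, prim (plateau δ a b) y ^ 2 ∂ν := by
  rw [← integral_indicator_one measurableSet_Icc]
  refine integral_mono ((integrable_const 1).indicator measurableSet_Icc) (integrable_prim_sq _)
    fun y => indicator_le' (fun y hy => ?_) (fun y _ => sq_nonneg _) y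
  rw [prim_plateau_of_mem hδ ha hab hb hy, one_pow, Pi.one_apply]

end Plateau

section Count

variable {ν : Measure ℝ}

theorem eigenCount_mono : Monotone (eigenCount ν) := fun _ _ hxy =>
  Cardinal.toENat.monotone' (Submodule.rank_mono (Submodule.span_mono
    fun _ ⟨l, hl, hf⟩ => ⟨l, hl.trans hxy, hf⟩))

theorem measure_Ioo_ne_zero (hν : ν ≠ 0) (hsupp : ν (Ioo 0 1)ᶜ = 0) : ν (Ioo 0 1) ≠ 0 :=
  fun h => hν <| by
    rw [← Measure.measure_univ_eq_zero, ← union_compl_self (Ioo (0 : ℝ) 1)]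
    exact measure_union_null h hsupp

variable [IsFiniteMeasure ν]

theorem exists_one_le_eigenCount (hν : ν ≠ 0) (hsupp : ν (Ioo 0 1)ᶜ = 0) :
    ∃ x, 1 ≤ eigenCount ν x := by
  set g := evalVec (1 / 2)
  have hpos : ∀ y ∈ Ioo (0 : ℝ) 1, 0 < prim g y := fun y hy => by
    rw [prim_evalVec (Ioo_subset_Icc_self hy) ⟨by norm_num, by norm_num⟩, sub_pos, lt_min_iff]
    constructor <;> linarith [hy.1, hy.2]
  have hint : 0 < ∫ y, prim g y ^ 2 ∂ν := by
    refine (integral_pos_iff_support_of_nonneg (fun y => sq_nonneg _) (integrable_prim_sq g)).2 ?_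
    exact (pos_iff_ne_zero.2 (measure_Ioo_ne_zero hν hsupp)).trans_le
      (measure_mono fun y hy => (pow_pos (hpos y hy) 2).ne')
  refine ⟨‖g‖ ^ 2 / ∫ y, prim g y ^ 2 ∂ν, ?_⟩
  have hg : g ≠ 0 := fun h => hint.ne' (by simp [h])
  simpa using card_le_eigenCount (g := fun _ : Unit => g) (fun _ => hg)
    (fun _ _ h => (h rfl).elim) (fun _ _ h => (h rfl).elim) fun _ => (div_mul_cancel₀ _ hint.ne').ge

theorem card_le_eigenCount_of_disjoint {ι : Type*} [Fintype ι] {a b : ι → ℝ} {δ x : ℝ}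
    (hδ : 0 < δ) (hx : 0 ≤ x) (ha : ∀ i, 0 ≤ a i - δ) (hab : ∀ i, a i ≤ b i) (hb : ∀ i, b i + δ ≤ 1)
    (hdisj : Pairwise fun i j => Disjoint (Ioo (a i - δ) (b i + δ)) (Ioo (a j - δ) (b j + δ)))
    (hν : ∀ i, 2 / δ ≤ x * ν.real (Icc (a i) (b i))) :
    (Fintype.card ι : ℕ∞) ≤ eigenCount ν x := by
  have hzero : ∀ i, ∀ y ∉ Ioo (a i - δ) (b i + δ), prim (plateau δ (a i) (b i)) y = 0 :=
    fun i y => prim_plateau_of_notMem hδ (ha i) (hab i) (hb i)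
  have hnorm : ∀ i, ‖plateau δ (a i) (b i)‖ ^ 2 = 2 / δ :=
    fun i => norm_sq_plateau hδ (ha i) (hab i) (hb i)
  refine card_le_eigenCount (g := fun i => plateau δ (a i) (b i)) (fun i h => ?_)
    (fun i j hij => ?_) (fun i j hij => ?_) fun i => ?_
  · have h2 := hnorm i
    rw [h, norm_zero, zero_pow two_ne_zero] at h2
    exact (div_pos two_pos hδ).ne h2
  · have hclosed : ∀ y ∈ Icc (a i - δ) (b i + δ), prim (plateau δ (a j) (b j)) y = 0 :=
      fun y hy => hzero j y fun hyj => disjoint_left.1 ((hdisj hij).symm.closure_right isOpen_Ioo)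
        hyj (by rwa [closure_Ioo (by linarith [hab i])])
    beta_reduce
    rw [inner_plateau, hclosed, hclosed, hclosed, hclosed]
    · ring
    all_goals constructor <;> linarith [hab i]
  · beta_reduce
    rw [inner_massEmbedding]
    refine integral_eq_zero_of_ae (.of_forall fun y => mul_eq_zero.2 ?_)
    by_cases hy : y ∈ Ioo (a i - δ) (b i + δ)
    exacts [.inr (hzero j y (disjoint_left.1 (hdisj hij) hy)), .inl (hzero i y hy)]
  · rw [hnorm]
    exact (hν i).trans (mul_le_mul_of_nonneg_left
      (measureReal_le_integral_prim_plateau_sq hδ (ha i) (hab i) (hb i)) hx)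

theorem card_le_eigenCount_of_mod_three {s : Finset ℕ} {n r : ℕ} {x : ℝ} (hx : 0 ≤ x)
    (hpos : ∀ k ∈ s, 1 ≤ k) (hlt : ∀ k ∈ s, k + 2 ≤ 2 ^ n) (hmod : ∀ k ∈ s, k % 3 = r)
    (hν : ∀ k ∈ s, 2 * 2 ^ n ≤ x * ν.real (dyadic n k)) : (s.card : ℕ∞) ≤ eigenCount ν x := by
  have h2n : (0 : ℝ) < 2 ^ n := by positivity
  rw [← Fintype.card_coe s]
  refine card_le_eigenCount_of_disjoint (a := fun k : s => (k : ℝ) / 2 ^ n)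
    (b := fun k => ((k : ℝ) + 1) / 2 ^ n) (δ := 1 / 2 ^ n) (by positivity) hx (fun k => ?_)
    (fun k => ?_) (fun k => ?_) (fun k l hkl => ?_) fun k => ?_
  · have h : (1 : ℝ) ≤ k := by exact_mod_cast hpos k k.2
    rw [← sub_div]
    exact div_nonneg (sub_nonneg.2 h) h2n.le
  · gcongr
    exact (lt_add_one _).le
  · have h : ((k : ℕ) : ℝ) + 2 ≤ 2 ^ n := by exact_mod_cast hlt k k.2
    rw [← add_div, div_le_one h2n]
    linarith
  · wlog h : (k : ℕ) < l generalizing k l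
    · exact (this l k hkl.symm ((not_lt.1 h).lt_of_ne fun h => hkl (Subtype.ext h.symm))).symm
    have h3 : (k : ℕ) + 3 ≤ l := by have := hmod k k.2; have := hmod l l.2; lia
    have h3' : ((k : ℕ) : ℝ) + 3 ≤ l := by exact_mod_cast h3
    refine disjoint_left.2 fun y hyk hyl => (hyk.2.trans_le (le_trans ?_ hyl.1.le)).false
    rw [← add_div, ← sub_div]
    gcongr
    linarith
  · rw [div_div_eq_mul_div, div_one]
    exact (hν k k.2).trans (mul_le_mul_of_nonneg_left (measureReal_mono Ioc_subset_Icc_self) hx)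

-- The two outermost intervals are discarded since a plateau on them does not fit into `(0, 1)`.
theorem coarseCount_le (α : ℝ) (n : ℕ) :
    (coarseCount ν α n : ℕ∞) ≤ 3 * eigenCount ν (2 * (2 : ℝ) ^ ((1 + α) * n)) + 2 := by
  classical
  set x : ℝ := 2 * (2 : ℝ) ^ ((1 + α) * n) with hx
  have hscale : x * (2 : ℝ) ^ (-α * n) = 2 * 2 ^ n := by
    rw [hx, mul_assoc, ← Real.rpow_add two_pos, ← Real.rpow_natCast]
    ring_nf
  rw [coarseCount]
  set s := (Finset.range (2 ^ n)).filter fun k => (2 : ℝ) ^ (-α * n) ≤ ν.real (dyadic n k) with hs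
  set t := s.filter fun k => 1 ≤ k ∧ k + 2 ≤ 2 ^ n with ht
  have hfiber : ∀ r, ((t.filter (· % 3 = r)).card : ℕ∞) ≤ eigenCount ν x := fun r => by
    refine card_le_eigenCount_of_mod_three (n := n) (r := r) (by positivity) ?_ ?_ ?_ ?_ <;>
      simp only [ht, hs, Finset.mem_filter] <;> rintro k ⟨⟨⟨-, hνk⟩, h1, h2⟩, h3⟩
    · exact h1
    · exact h2
    · exact h3
    · rw [← hscale]
      gcongr
  have ht_card : (t.card : ℕ∞) ≤ 3 * eigenCount ν x := by
    rw [Finset.card_eq_sum_card_fiberwise (f := (· % 3)) (t := Finset.range 3)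
      fun k _ => Finset.mem_coe.2 (Finset.mem_range.2 (k.mod_lt three_pos)), Nat.cast_sum]
    exact (Finset.sum_le_card_nsmul _ _ _ fun r _ => hfiber r).trans_eq (by simp)
  have hs_card : s.card ≤ t.card + 2 := by
    have hcover : s ⊆ t ∪ {0, 2 ^ n - 1} := fun k hk => by
      have hk' := (Finset.mem_filter.1 hk).1
      simp only [ht, Finset.mem_union, Finset.mem_filter, Finset.mem_insert, Finset.mem_singleton,
        Finset.mem_range] at hk' ⊢
      by_cases h : 1 ≤ k ∧ k + 2 ≤ 2 ^ n
      exacts [.inl ⟨hk, h⟩, .inr (by lia)]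
    exact (Finset.card_le_card hcover).trans ((Finset.card_union_le _ _).trans
      (Nat.add_le_add_left Finset.card_le_two _))
  exact (Nat.cast_le.2 hs_card).trans (by push_cast; gcongr)

end Count

/-! ### The partition function and its fixed points -/

section Partition

open Classical in
/-- The indices `k` of the dyadic intervals `(k 2⁻ⁿ, (k+1) 2⁻ⁿ]` in `(0,1]` that carry mass; these
are the indices over which `betaN` sums. -/
def charged (ν : Measure ℝ) (n : ℕ) : Finset ℕ :=
  (Finset.range (2 ^ n)).filter fun k => 0 < ν (dyadic n k)

/-- The partition function `q ↦ ∑ ν(C)^q` of level `n`, whose logarithm in base `2ⁿ` is `β_n`. -/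
def partSum (ν : Measure ℝ) (n : ℕ) (q : ℝ) : ℝ := ∑ k ∈ charged ν n, ν.real (dyadic n k) ^ q

/-- The error term in the monotonicity of `β_n`; it vanishes if `ν` has mass at most one. -/
def massErr (ν : Measure ℝ) (n : ℕ) : ℝ := Real.log (max 1 (ν.real univ)) / (n * Real.log 2)

variable {ν : Measure ℝ}

theorem betaN_eq (n : ℕ) (q : ℝ) : betaN ν n q = Real.log (partSum ν n q) / (n * Real.log 2) := by
  rw [betaN, partSum, charged, Real.log_pow]

theorem Ioo_subset_iUnion_dyadic (n : ℕ) :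
    Ioo (0 : ℝ) 1 ⊆ ⋃ k ∈ Finset.range (2 ^ n), dyadic n k := fun x hx => by
  have h2n : (0 : ℝ) < 2 ^ n := by positivity
  obtain ⟨k, hk⟩ := Nat.exists_eq_succ_of_ne_zero (Nat.ceil_pos.2 (mul_pos hx.1 h2n)).ne'
  have hlt : (k : ℝ) < x * 2 ^ n := Nat.lt_ceil.1 (by lia)
  have hle : x * 2 ^ n ≤ k + 1 := by exact_mod_cast hk ▸ Nat.le_ceil (x * 2 ^ n)
  have hk2 : (k : ℝ) < 2 ^ n := hlt.trans (mul_lt_of_lt_one_left h2n hx.2)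
  simp only [mem_iUnion, Finset.mem_range]
  exact ⟨k, by exact_mod_cast hk2, (div_lt_iff₀ h2n).2 hlt, (le_div_iff₀ h2n).2 hle⟩

theorem charged_nonempty (hν : ν ≠ 0) (hsupp : ν (Ioo 0 1)ᶜ = 0) (n : ℕ) :
    (charged ν n).Nonempty := by
  by_contra hne
  rw [Finset.not_nonempty_iff_eq_empty, charged, Finset.filter_eq_empty_iff] at hne
  exact measure_Ioo_ne_zero hν hsupp (measure_mono_null (Ioo_subset_iUnion_dyadic n)
    (measure_iUnion_null fun k => measure_iUnion_null fun hk => by simpa using hne hk))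

theorem tendsto_massErr : Tendsto (massErr ν) atTop (𝓝 0) :=
  tendsto_const_nhds.div_atTop
    (tendsto_natCast_atTop_atTop.atTop_mul_const (Real.log_pos one_lt_two))

theorem betaN_zero_nonneg (n : ℕ) : 0 ≤ betaN ν n 0 := by
  rw [betaN_eq, partSum]
  simp only [Real.rpow_zero, Finset.sum_const, nsmul_eq_mul, mul_one]
  exact div_nonneg (Real.log_natCast_nonneg _)
    (mul_nonneg (by positivity) (Real.log_pos one_lt_two).le)

theorem card_mul_rpow_le_partSum {s : Finset ℕ} {n : ℕ} {t q : ℝ} (ht : 0 < t) (hq : 0 ≤ q)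
    (hlt : ∀ k ∈ s, k < 2 ^ n) (hle : ∀ k ∈ s, t ≤ ν.real (dyadic n k)) :
    s.card * t ^ q ≤ partSum ν n q := by
  have hsub : s ⊆ charged ν n := fun k hk => Finset.mem_filter.2
    ⟨Finset.mem_range.2 (hlt k hk), (ENNReal.toReal_pos_iff.1 (ht.trans_le (hle k hk))).1⟩
  rw [← nsmul_eq_mul]
  exact (Finset.card_nsmul_le_sum _ _ _ fun k hk => Real.rpow_le_rpow ht.le (hle k hk) hq).trans
    (Finset.sum_le_sum_of_subset_of_nonneg hsub fun _ _ _ => Real.rpow_nonneg measureReal_nonneg q)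

variable [IsFiniteMeasure ν]

theorem measureReal_pos_of_mem_charged {n k : ℕ} (hk : k ∈ charged ν n) :
    0 < ν.real (dyadic n k) :=
  ENNReal.toReal_pos (Finset.mem_filter.1 hk).2.ne' (measure_ne_top _ _)

theorem partSum_pos (hν : ν ≠ 0) (hsupp : ν (Ioo 0 1)ᶜ = 0) (n : ℕ) (q : ℝ) :
    0 < partSum ν n q :=
  Finset.sum_pos (fun _ hk => Real.rpow_pos_of_pos (measureReal_pos_of_mem_charged hk) q)
    (charged_nonempty hν hsupp n)

theorem partSum_le_mul_partSum {q r : ℝ} (hqr : q ≤ r) (n : ℕ) :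
    partSum ν n r ≤ max 1 (ν.real univ) ^ (r - q) * partSum ν n q := by
  rw [partSum, partSum, Finset.mul_sum]
  refine Finset.sum_le_sum fun k hk => ?_
  have hp := measureReal_pos_of_mem_charged hk
  rw [← sub_add_cancel r q, Real.rpow_add hp, sub_add_cancel]
  gcongr
  exact (measureReal_mono (subset_univ _)).trans (le_max_right _ _)

variable {n : ℕ} {q r : ℝ}

theorem partSum_eq_rpow (hν : ν ≠ 0) (hsupp : ν (Ioo 0 1)ᶜ = 0) (hn : 0 < n) (q : ℝ) :
    partSum ν n q = (2 : ℝ) ^ (n * betaN ν n q) := by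
  have hlog : (n : ℝ) * Real.log 2 ≠ 0 :=
    mul_ne_zero (Nat.cast_ne_zero.2 hn.ne') (Real.log_pos one_lt_two).ne'
  rw [betaN_eq, Real.rpow_def_of_pos two_pos, ← mul_assoc, mul_comm (Real.log 2),
    mul_div_cancel₀ _ hlog, Real.exp_log (partSum_pos hν hsupp n q)]

theorem betaN_le_add (hν : ν ≠ 0) (hsupp : ν (Ioo 0 1)ᶜ = 0) (hn : 0 < n) (hqr : q ≤ r) :
    betaN ν n r ≤ betaN ν n q + (r - q) * massErr ν n := by
  have hM : 0 < max 1 (ν.real univ) := lt_max_of_lt_left one_pos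
  have hd : 0 < (n : ℝ) * Real.log 2 := mul_pos (by positivity) (Real.log_pos one_lt_two)
  rw [betaN_eq, betaN_eq, massErr, ← mul_div_assoc, ← add_div, div_le_div_iff_of_pos_right hd,
    add_comm, ← Real.log_rpow hM, ← Real.log_mul (Real.rpow_pos_of_pos hM _).ne'
      (partSum_pos hν hsupp n q).ne']
  exact Real.log_le_log (partSum_pos hν hsupp n r) (partSum_le_mul_partSum hqr n)

theorem betaN_zero_le_one (hν : ν ≠ 0) (hsupp : ν (Ioo 0 1)ᶜ = 0) (hn : 0 < n) :
    betaN ν n 0 ≤ 1 := by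
  have h : (2 : ℝ) ^ (n * betaN ν n 0) ≤ 2 ^ (n : ℝ) := by
    rw [← partSum_eq_rpow hν hsupp hn, partSum, Real.rpow_natCast]
    simp only [Real.rpow_zero, Finset.sum_const, nsmul_eq_mul, mul_one]
    exact_mod_cast (Finset.card_filter_le _ _).trans_eq (Finset.card_range _)
  exact (mul_le_iff_le_one_right (by positivity)).1 ((Real.rpow_le_rpow_left_iff one_lt_two).1 h)

theorem strictAnti_betaN_sub (hν : ν ≠ 0) (hsupp : ν (Ioo 0 1)ᶜ = 0) (hn : 0 < n)
    (herr : massErr ν n < 1) :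
    StrictAnti fun q => betaN ν n q - q := fun q r hqr => by
  have h1 := betaN_le_add hν hsupp hn hqr.le
  have h2 : (r - q) * massErr ν n < (r - q) * 1 := mul_lt_mul_of_pos_left herr (sub_pos.2 hqr)
  change betaN ν n r - r < betaN ν n q - q
  linarith

theorem eventually_strictAnti_betaN_sub (hν : ν ≠ 0) (hsupp : ν (Ioo 0 1)ᶜ = 0) :
    ∀ᶠ n in atTop, StrictAnti fun q => betaN ν n q - q := by
  filter_upwards [eventually_gt_atTop 0, tendsto_massErr.eventually_lt_const one_pos] with n
    using strictAnti_betaN_sub hν hsupp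

theorem eventually_betaN_fixedPt (hν : ν ≠ 0) (hsupp : ν (Ioo 0 1)ᶜ = 0) :
    ∀ᶠ n in atTop, betaN ν n (fixedPt ν n) = fixedPt ν n := by
  filter_upwards [eventually_existsUnique_fixedPoint ν hν hsupp] with n ⟨p, hp, hpu⟩
  have hfix : Function.fixedPoints (betaN ν n) = {p} :=
    eq_singleton_iff_unique_mem.2 ⟨hp, fun r hr => hpu r hr⟩
  rw [fixedPt, hfix, csInf_singleton, hp]

theorem eventually_fixedPt_mem_Icc (hν : ν ≠ 0) (hsupp : ν (Ioo 0 1)ᶜ = 0) :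
    ∀ᶠ n in atTop, fixedPt ν n ∈ Icc 0 2 := by
  filter_upwards [eventually_betaN_fixedPt hν hsupp, eventually_strictAnti_betaN_sub hν hsupp,
    eventually_gt_atTop 0, tendsto_massErr.eventually_le_const (by norm_num : (0 : ℝ) < 1 / 2)]
    with n hfix hanti hn herr
  have hnonneg : 0 ≤ fixedPt ν n := hanti.le_iff_ge.1 <| by
    change betaN ν n (fixedPt ν n) - fixedPt ν n ≤ betaN ν n 0 - 0
    rw [hfix, sub_self, sub_zero]
    exact betaN_zero_nonneg n
  refine ⟨hnonneg, ?_⟩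
  have h1 := betaN_le_add hν hsupp hn hnonneg
  have h2 : (fixedPt ν n - 0) * massErr ν n ≤ (fixedPt ν n - 0) * (1 / 2) := by gcongr
  linarith [betaN_zero_le_one hν hsupp hn]

theorem isBoundedUnder_le_fixedPt (hν : ν ≠ 0) (hsupp : ν (Ioo 0 1)ᶜ = 0) :
    IsBoundedUnder (· ≤ ·) atTop (fixedPt ν) :=
  ⟨2, eventually_map.2 ((eventually_fixedPt_mem_Icc hν hsupp).mono fun _ h => h.2)⟩

theorem isBoundedUnder_ge_fixedPt (hν : ν ≠ 0) (hsupp : ν (Ioo 0 1)ᶜ = 0) :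
    IsBoundedUnder (· ≥ ·) atTop (fixedPt ν) :=
  ⟨0, eventually_map.2 ((eventually_fixedPt_mem_Icc hν hsupp).mono fun _ h => h.1)⟩

theorem qBar_nonneg (hν : ν ≠ 0) (hsupp : ν (Ioo 0 1)ᶜ = 0) : 0 ≤ qBar ν :=
  le_limsup_of_frequently_le
    ((eventually_fixedPt_mem_Icc hν hsupp).mono fun _ h => h.1).frequently
    (isBoundedUnder_le_fixedPt hν hsupp)

theorem eventually_betaN_le (hν : ν ≠ 0) (hsupp : ν (Ioo 0 1)ᶜ = 0) (hq : qBar ν < q) :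
    ∀ᶠ n in atTop, betaN ν n q ≤ q := by
  filter_upwards [eventually_lt_of_limsup_lt hq (isBoundedUnder_le_fixedPt hν hsupp),
    eventually_betaN_fixedPt hν hsupp, eventually_strictAnti_betaN_sub hν hsupp]
    with n hlt hfix hanti
  exact sub_nonpos.1 ((hanti hlt).le.trans_eq (sub_eq_zero.2 hfix))

theorem le_beta_of_lt_qBar (hν : ν ≠ 0) (hsupp : ν (Ioo 0 1)ᶜ = 0) (hq : q < qBar ν) :
    (q : EReal) ≤ beta ν q := by
  have hfreq := frequently_lt_of_lt_limsup
    (isBoundedUnder_ge_fixedPt hν hsupp).isCoboundedUnder_le hq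
  refine le_limsup_of_frequently_le ((hfreq.and_eventually
    ((eventually_betaN_fixedPt hν hsupp).and (eventually_strictAnti_betaN_sub hν hsupp))).mono
      fun n ⟨hlt, hfix, hanti⟩ => EReal.coe_le_coe_iff.2 ?_)
  exact sub_nonneg.1 ((sub_eq_zero.2 hfix).symm.trans_le (hanti hlt).le)

theorem antitone_beta (hν : ν ≠ 0) (hsupp : ν (Ioo 0 1)ᶜ = 0) :
    Antitone (beta ν) := fun q r hqr => by
  refine EReal.le_of_forall_lt_iff_le.1 fun z hz => ?_
  obtain ⟨y, hqy, hyz⟩ := EReal.lt_iff_exists_real_btwn.1 hz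
  have herr : Tendsto (fun n => y + (r - q) * massErr ν n) atTop (𝓝 y) := by
    simpa using (tendsto_massErr.const_mul (r - q)).const_add y
  refine limsup_le_of_le (by isBoundedDefault) ?_
  filter_upwards [eventually_lt_of_limsup_lt hqy, eventually_gt_atTop 0,
    herr.eventually_le_const (EReal.coe_lt_coe_iff.1 hyz)] with n hn hn0 hle
  have h := betaN_le_add hν hsupp hn0 hqr
  exact EReal.coe_le_coe_iff.2 (by linarith [EReal.coe_lt_coe_iff.1 hn])

theorem beta_ne_top (hν : ν ≠ 0) (hsupp : ν (Ioo 0 1)ᶜ = 0) (hq : 0 ≤ q) : beta ν q ≠ ⊤ := by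
  have h0 : beta ν 0 ≤ (1 : ℝ) := limsup_le_of_le (by isBoundedDefault) <| by
    filter_upwards [eventually_gt_atTop 0] with n hn
    exact EReal.coe_le_coe_iff.2 (betaN_zero_le_one hν hsupp hn)
  exact (((antitone_beta hν hsupp hq).trans h0).trans_lt (EReal.coe_lt_top 1)).ne

theorem beta_ne_bot (hν : ν ≠ 0) (hsupp : ν (Ioo 0 1)ᶜ = 0) (hq : q < qBar ν) : beta ν q ≠ ⊥ :=
  ((EReal.bot_lt_coe q).trans_le (le_beta_of_lt_qBar hν hsupp hq)).ne'

end Partition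

/-! ### Coarse multifractal dimensions -/

section Coarse

variable {ν : Measure ℝ} {n : ℕ} {q c h t α γ η : ℝ}

theorem coarseRatio_nonneg (α : ℝ) (n : ℕ) : 0 ≤ coarseRatio ν α n :=
  div_nonneg Real.posLog_nonneg (Real.log_nonneg (one_le_pow₀ one_le_two))

theorem two_rpow_coarseRatio (hn : 0 < n) (α : ℝ) :
    (2 : ℝ) ^ (n * coarseRatio ν α n) = max 1 (coarseCount ν α n : ℝ) := by
  have hd : (n : ℝ) * Real.log 2 ≠ 0 :=
    mul_ne_zero (Nat.cast_ne_zero.2 hn.ne') (Real.log_pos one_lt_two).ne'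
  rw [coarseRatio, Real.posLog_eq_log_max_one (Nat.cast_nonneg _), Real.log_pow,
    Real.rpow_def_of_pos two_pos, ← mul_assoc, mul_comm (Real.log 2), mul_div_cancel₀ _ hd,
    Real.exp_log (lt_max_of_lt_left one_pos)]

theorem coarseRatio_le_iff (hn : 0 < n) (hc : 0 ≤ c) :
    coarseRatio ν α n ≤ c ↔ (coarseCount ν α n : ℝ) ≤ 2 ^ (n * c) := by
  rw [← mul_le_mul_iff_right₀ (Nat.cast_pos.2 hn : (0 : ℝ) < n),
    ← Real.rpow_le_rpow_left_iff one_lt_two, two_rpow_coarseRatio hn, max_le_iff]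
  exact and_iff_right (Real.one_le_rpow one_le_two (by positivity))

theorem le_coarseRatio (hn : 0 < n) (hc : (2 : ℝ) ^ (n * c) ≤ coarseCount ν α n) :
    c ≤ coarseRatio ν α n := by
  rw [← mul_le_mul_iff_right₀ (Nat.cast_pos.2 hn : (0 : ℝ) < n),
    ← Real.rpow_le_rpow_left_iff one_lt_two, two_rpow_coarseRatio hn]
  exact hc.trans (le_max_right _ _)

theorem coarseRatio_le_one (α : ℝ) (n : ℕ) : coarseRatio ν α n ≤ 1 := by
  rcases n.eq_zero_or_pos with rfl | hn
  · simp [coarseRatio]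
  · rw [coarseRatio_le_iff hn zero_le_one, mul_one, Real.rpow_natCast]
    exact_mod_cast (Finset.card_filter_le _ _).trans_eq (Finset.card_range _)

theorem isBoundedUnder_le_coarseRatio (α : ℝ) : IsBoundedUnder (· ≤ ·) atTop (coarseRatio ν α) :=
  isBoundedUnder_of ⟨1, coarseRatio_le_one α⟩

theorem isBoundedUnder_ge_coarseRatio (α : ℝ) : IsBoundedUnder (· ≥ ·) atTop (coarseRatio ν α) :=
  isBoundedUnder_of ⟨0, coarseRatio_nonneg α⟩

theorem liminf_coarseRatio_le_limsup (α : ℝ) :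
    liminf (coarseRatio ν α) atTop ≤ limsup (coarseRatio ν α) atTop :=
  liminf_le_limsup (isBoundedUnder_le_coarseRatio α) (isBoundedUnder_ge_coarseRatio α)

theorem liminf_coarseRatio_nonneg (α : ℝ) : 0 ≤ liminf (coarseRatio ν α) atTop :=
  le_liminf_of_le (isBoundedUnder_le_coarseRatio α).isCoboundedUnder_ge
    (Eventually.of_forall (coarseRatio_nonneg α))

theorem limsup_coarseRatio_div_le_one (hα : 0 < α) :
    limsup (coarseRatio ν α) atTop / (1 + α) ≤ 1 := by
  have h : limsup (coarseRatio ν α) atTop ≤ 1 :=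
    limsup_le_of_le (isBoundedUnder_ge_coarseRatio α).isCoboundedUnder_le
      (Eventually.of_forall (coarseRatio_le_one α))
  exact (div_le_one (by positivity)).2 (by linarith)

theorem liminf_coarseRatio_div_le (hα : 0 < α) :
    liminf (coarseRatio ν α) atTop / (1 + α) ≤ limsup (coarseRatio ν α) atTop / (1 + α) :=
  div_le_div_of_nonneg_right (liminf_coarseRatio_le_limsup α) (by positivity)

theorem le_lowerF (hα : 0 < α) : liminf (coarseRatio ν α) atTop / (1 + α) ≤ lowerF ν := by
  refine le_ciSup (f := fun α : Ioi (0 : ℝ) => liminf (coarseRatio ν α) atTop / (1 + (α : ℝ)))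
    ⟨1, ?_⟩ ⟨α, hα⟩
  rintro _ ⟨α, rfl⟩
  exact (liminf_coarseRatio_div_le α.2).trans (limsup_coarseRatio_div_le_one α.2)

theorem lowerF_nonneg : 0 ≤ lowerF ν :=
  (div_nonneg (liminf_coarseRatio_nonneg 1) (by norm_num)).trans (le_lowerF one_pos)

theorem lowerF_le_upperF : lowerF ν ≤ upperF ν := by
  refine ciSup_mono ⟨1, ?_⟩ fun α => liminf_coarseRatio_div_le α.2
  rintro _ ⟨α, rfl⟩
  exact limsup_coarseRatio_div_le_one α.2

theorem rpow_le_of_cutoffs {p s : ℝ} (hp : 0 < p) (hs : 0 < s) (ht : 0 < t) (hq : 0 ≤ q)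
    (hh : 0 ≤ h) :
    p ^ q ≤ s ^ h * p ^ (q - h) + t ^ (-h) * p ^ (q + h) + if s ≤ p then t ^ q else 0 := by
  have hsmall : 0 ≤ s ^ h * p ^ (q - h) := by positivity
  have hlarge : 0 ≤ t ^ (-h) * p ^ (q + h) := by positivity
  split_ifs with hsp
  · rcases le_total p t with hpt | htp
    · linarith [Real.rpow_le_rpow hp.le hpt hq]
    · have h1 : t ^ h ≤ p ^ h := Real.rpow_le_rpow ht.le htp hh
      have h2 : p ^ q ≤ t ^ (-h) * p ^ (q + h) := by
        rw [Real.rpow_neg ht.le, ← div_eq_inv_mul, le_div_iff₀ (by positivity), Real.rpow_add hp]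
        gcongr
      have h3 : 0 ≤ t ^ q := by positivity
      linarith
  · have h1 : p ^ h ≤ s ^ h := Real.rpow_le_rpow hp.le (not_le.1 hsp).le hh
    have h2 : p ^ q ≤ s ^ h * p ^ (q - h) := by
      rw [Real.rpow_sub hp, mul_div_left_comm]
      exact le_mul_of_one_le_right (by positivity) ((one_le_div (by positivity)).2 h1)
    linarith

variable [IsFiniteMeasure ν]

theorem partSum_le_of_cutoff (ht : 0 < t) (hq : 0 ≤ q) (hh : 0 ≤ h) (α : ℝ) (n : ℕ) :
    partSum ν n q ≤ ((2 : ℝ) ^ (-α * n)) ^ h * partSum ν n (q - h) +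
      t ^ (-h) * partSum ν n (q + h) + coarseCount ν α n * t ^ q := by
  refine (Finset.sum_le_sum fun k hk => rpow_le_of_cutoffs (measureReal_pos_of_mem_charged hk)
    (by positivity : (0 : ℝ) < 2 ^ (-α * n)) ht hq hh).trans ?_
  rw [Finset.sum_add_distrib, Finset.sum_add_distrib, ← Finset.mul_sum, ← Finset.mul_sum,
    ← Finset.sum_filter, Finset.sum_const, nsmul_eq_mul, coarseCount]
  gcongr
  exacts [le_rfl, le_rfl, Finset.filter_subset _ _]

theorem coarseCount_le_rpow (hν : ν ≠ 0) (hsupp : ν (Ioo 0 1)ᶜ = 0) (hq : 0 ≤ q) (α : ℝ)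
    (hn : 0 < n) : (coarseCount ν α n : ℝ) ≤ 2 ^ (n * (betaN ν n q + α * q)) := by
  have hle : coarseCount ν α n * ((2 : ℝ) ^ (-α * n)) ^ q ≤ partSum ν n q :=
    card_mul_rpow_le_partSum (by positivity) hq
      (fun _ hk => Finset.mem_range.1 (Finset.mem_filter.1 hk).1)
      fun _ hk => (Finset.mem_filter.1 hk).2
  rw [partSum_eq_rpow hν hsupp hn, ← Real.rpow_mul zero_le_two, ← le_div_iff₀ (by positivity),
    ← Real.rpow_sub two_pos] at hle
  exact hle.trans_eq (by ring_nf)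

theorem upperF_le_qBar (hν : ν ≠ 0) (hsupp : ν (Ioo 0 1)ᶜ = 0) : upperF ν ≤ qBar ν := by
  refine le_of_forall_gt_imp_ge_of_dense fun q hq => ciSup_le fun ⟨α, (hα : 0 < α)⟩ => ?_
  have hq0 : 0 ≤ q := (qBar_nonneg hν hsupp).trans hq.le
  rw [div_le_iff₀ (by positivity)]
  refine limsup_le_of_le (isBoundedUnder_ge_coarseRatio _).isCoboundedUnder_le ?_
  filter_upwards [eventually_betaN_le hν hsupp hq, eventually_gt_atTop 0] with n hβ hn
  refine (coarseRatio_le_iff hn (by positivity)).2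
    ((coarseCount_le_rpow hν hsupp hq0 α hn).trans ?_)
  gcongr
  · exact one_le_two
  · linarith

theorem rpow_le_coarseCount (hν : ν ≠ 0) (hsupp : ν (Ioo 0 1)ᶜ = 0) (hn : 0 < n) (hq : 0 ≤ q)
    (hh : 0 ≤ h) (h3 : 3 ≤ (2 : ℝ) ^ (n * η)) (hc : c ≤ betaN ν n q)
    (hl : betaN ν n (q - h) ≤ c + α * h - η) (hr : betaN ν n (q + h) ≤ c - γ * h - η) :
    (2 : ℝ) ^ (n * (c - η + γ * q)) ≤ coarseCount ν α n := by
  have hsum := partSum_le_of_cutoff (ν := ν) (by positivity : (0 : ℝ) < 2 ^ (-γ * n)) hq hh α n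
  simp only [partSum_eq_rpow hν hsupp hn, ← Real.rpow_mul zero_le_two, ← Real.rpow_add two_pos]
    at hsum
  set u : ℝ := 2 ^ (n * (c - η))
  have hmain : 3 * u ≤ 2 ^ (n * betaN ν n q) := calc
    3 * u ≤ 2 ^ (n * η) * u := by gcongr
    _ = 2 ^ (n * c) := by rw [← Real.rpow_add two_pos]; ring_nf
    _ ≤ 2 ^ (n * betaN ν n q) := by gcongr; exact one_le_two
  have hsmall : (2 : ℝ) ^ (-α * n * h + n * betaN ν n (q - h)) ≤ u := by
    rw [show -α * n * h + n * betaN ν n (q - h) = n * (betaN ν n (q - h) - α * h) by ring]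
    exact Real.rpow_le_rpow_of_exponent_le one_le_two
      (mul_le_mul_of_nonneg_left (by linarith) n.cast_nonneg)
  have hlarge : (2 : ℝ) ^ (-γ * n * -h + n * betaN ν n (q + h)) ≤ u := by
    rw [show -γ * n * -h + n * betaN ν n (q + h) = n * (betaN ν n (q + h) + γ * h) by ring]
    exact Real.rpow_le_rpow_of_exponent_le one_le_two
      (mul_le_mul_of_nonneg_left (by linarith) n.cast_nonneg)
  have hu : u ≤ coarseCount ν α n * 2 ^ (-γ * n * q) := by linarith
  rw [← div_le_iff₀ (by positivity), ← Real.rpow_sub two_pos] at hu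
  exact le_of_eq_of_le (by ring_nf) hu

theorem le_liminf_coarseRatio (hν : ν ≠ 0) (hsupp : ν (Ioo 0 1)ᶜ = 0) (hq : 0 ≤ q) (hh : 0 ≤ h)
    (hη : 0 < η) (hc : (c : EReal) < lowerBeta ν q)
    (hl : beta ν (q - h) < (c + α * h - η : ℝ)) (hr : beta ν (q + h) < (c - γ * h - η : ℝ)) :
    c - η + γ * q ≤ liminf (coarseRatio ν α) atTop := by
  have hpow : Tendsto (fun n : ℕ => (2 : ℝ) ^ ((n : ℝ) * η)) atTop atTop :=
    (tendsto_rpow_atTop_of_base_gt_one 2 one_lt_two).comp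
      (tendsto_natCast_atTop_atTop.atTop_mul_const hη)
  refine le_liminf_of_le (isBoundedUnder_le_coarseRatio α).isCoboundedUnder_ge ?_
  filter_upwards [eventually_lt_of_lt_liminf hc, eventually_lt_of_limsup_lt hl,
    eventually_lt_of_limsup_lt hr, hpow.eventually_ge_atTop 3, eventually_gt_atTop 0]
    with n hcn hln hrn h3 hn
  exact le_coarseRatio hn (rpow_le_coarseCount hν hsupp hn hq hh h3
    (EReal.coe_lt_coe_iff.1 hcn).le (EReal.coe_lt_coe_iff.1 hln).le (EReal.coe_lt_coe_iff.1 hrn).le)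

end Coarse

/-! ### Regularity -/

theorem eventually_lt_of_hasDerivAt {f : ℝ → ℝ} {f' x δ : ℝ} (hf : HasDerivAt f f' x)
    (hδ : 0 < δ) : ∀ᶠ h in 𝓝[>] 0, f (x + h) < f x + (f' + δ) * h := by
  have hslope := (hasDerivAt_iff_tendsto_slope_zero.1 hf).mono_left (nhdsGT_le_nhdsNE 0)
  filter_upwards [hslope.eventually_lt_const (lt_add_of_pos_right f' hδ), self_mem_nhdsWithin]
    with h hlt hh
  rw [smul_eq_mul, inv_mul_lt_iff₀ hh] at hlt
  linarith

section Regular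

variable {ν : Measure ℝ} [IsFiniteMeasure ν] {q : ℝ}

theorem antitoneOn_toReal_beta (hν : ν ≠ 0) (hsupp : ν (Ioo 0 1)ᶜ = 0) {s : Set ℝ}
    (hs : ∀ y ∈ s, beta ν y ≠ ⊤ ∧ beta ν y ≠ ⊥) : AntitoneOn (fun y => (beta ν y).toReal) s :=
  fun y hy z hz hyz =>
    EReal.toReal_le_toReal (antitone_beta hν hsupp hyz) (hs z hz).2 (hs y hy).1

theorem deriv_toReal_beta_nonpos (hν : ν ≠ 0) (hsupp : ν (Ioo 0 1)ᶜ = 0)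
    (hfin : ∀ᶠ y in 𝓝 q, beta ν y ≠ ⊤ ∧ beta ν y ≠ ⊥) :
    deriv (fun y => (beta ν y).toReal) q ≤ 0 := by
  rw [← derivWithin_of_mem_nhds hfin]
  exact (antitoneOn_toReal_beta hν hsupp fun _ hy => hy).derivWithin_nonpos

theorem le_toReal_beta_of_lt_qBar (hν : ν ≠ 0) (hsupp : ν (Ioo 0 1)ᶜ = 0) (hq : q < qBar ν)
    (htop : beta ν q ≠ ⊤) : q ≤ (beta ν q).toReal := by
  rw [← EReal.coe_le_coe_iff, EReal.coe_toReal htop (beta_ne_bot hν hsupp hq)]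
  exact le_beta_of_lt_qBar hν hsupp hq

theorem toReal_beta_sub_add_le_lowerF_mul (hν : ν ≠ 0) (hsupp : ν (Ioo 0 1)ᶜ = 0) {f' δ : ℝ}
    (hq : 0 ≤ q) (hβ : beta ν q = lowerBeta ν q)
    (hfin : ∀ᶠ y in 𝓝 q, beta ν y ≠ ⊤ ∧ beta ν y ≠ ⊥)
    (hd : HasDerivAt (fun y => (beta ν y).toReal) f' q) (hδ : 0 < δ) :
    (beta ν q).toReal - δ + (-f' - δ) * q ≤ lowerF ν * (1 + (-f' + δ)) := by
  set f : ℝ → ℝ := fun y => (beta ν y).toReal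
  have hcoe : ∀ {y c}, beta ν y ≠ ⊤ ∧ beta ν y ≠ ⊥ → f y < c → beta ν y < (c : ℝ) := fun hy hc =>
    (EReal.coe_toReal hy.1 hy.2).symm.trans_lt (EReal.coe_lt_coe_iff.2 hc)
  have hleft : HasDerivAt (fun h => f (q - h)) (-f') 0 := .comp_const_sub q 0 (by rwa [sub_zero])
  have hsub : Tendsto (fun h => q - h) (𝓝[>] 0) (𝓝 q) :=
    ((by fun_prop : Continuous _).tendsto' 0 q (sub_zero q)).mono_left nhdsWithin_le_nhds
  have hadd : Tendsto (fun h => q + h) (𝓝[>] 0) (𝓝 q) :=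
    ((by fun_prop : Continuous _).tendsto' 0 q (add_zero q)).mono_left nhdsWithin_le_nhds
  obtain ⟨h, ⟨hh, hh1⟩, ⟨hl, hr⟩, hlfin, hrfin⟩ := (Eventually.and (Ioo_mem_nhdsGT one_pos)
    (((eventually_lt_of_hasDerivAt hleft (half_pos hδ)).and
      (eventually_lt_of_hasDerivAt hd (half_pos hδ))).and
        ((hsub.eventually hfin).and (hadd.eventually hfin)))).exists
  simp only [zero_add, sub_zero] at hl
  have hδh : 0 < δ * h := mul_pos hδ hh
  have hc : ((f q - δ * h / 4 : ℝ) : EReal) < lowerBeta ν q := by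
    rw [← hβ, ← EReal.coe_toReal hfin.self_of_nhds.1 hfin.self_of_nhds.2]
    exact EReal.coe_lt_coe_iff.2 (by linarith)
  have hlim := le_liminf_coarseRatio hν hsupp (α := -f' + δ) (γ := -f' - δ) (η := δ * h / 4) hq
    hh.le (by linarith) hc (hcoe hlfin (by linarith)) (hcoe hrfin (by linarith))
  have hf' : f' ≤ 0 := hd.deriv ▸ deriv_toReal_beta_nonpos hν hsupp hfin
  have hF := le_lowerF (ν := ν) (by linarith : 0 < -f' + δ)
  rw [div_le_iff₀ (by linarith)] at hF
  have : δ * h ≤ δ := mul_le_of_le_one_right hδ.le hh1.le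
  linarith

theorem toReal_beta_sub_le_lowerF_mul (hν : ν ≠ 0) (hsupp : ν (Ioo 0 1)ᶜ = 0) {f' : ℝ}
    (hq : 0 ≤ q) (hβ : beta ν q = lowerBeta ν q)
    (hfin : ∀ᶠ y in 𝓝 q, beta ν y ≠ ⊤ ∧ beta ν y ≠ ⊥)
    (hd : HasDerivAt (fun y => (beta ν y).toReal) f' q) :
    (beta ν q).toReal - f' * q ≤ lowerF ν * (1 - f') := by
  have hlhs : Tendsto (fun δ => (beta ν q).toReal - δ + (-f' - δ) * q) (𝓝[>] 0)
      (𝓝 ((beta ν q).toReal - f' * q)) :=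
    ((by fun_prop : Continuous _).tendsto' 0 _ (by ring)).mono_left nhdsWithin_le_nhds
  have hrhs : Tendsto (fun δ => lowerF ν * (1 + (-f' + δ))) (𝓝[>] 0) (𝓝 (lowerF ν * (1 - f'))) :=
    ((by fun_prop : Continuous _).tendsto' 0 _ (by ring)).mono_left nhdsWithin_le_nhds
  refine le_of_tendsto_of_tendsto hlhs hrhs ?_
  filter_upwards [self_mem_nhdsWithin] with δ hδ
  exact toReal_beta_sub_add_le_lowerF_mul hν hsupp hq hβ hfin hd hδ

theorem le_lowerF_of_differentiableAt (hν : ν ≠ 0) (hsupp : ν (Ioo 0 1)ᶜ = 0) (hq : 0 ≤ q)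
    (hβ : beta ν q = lowerBeta ν q) (hle : q ≤ (beta ν q).toReal)
    (hfin : ∀ᶠ y in 𝓝 q, beta ν y ≠ ⊤ ∧ beta ν y ≠ ⊥)
    (hd : DifferentiableAt ℝ (fun y => (beta ν y).toReal) q) : q ≤ lowerF ν := by
  have hslope := deriv_toReal_beta_nonpos hν hsupp hfin
  have htangent := toReal_beta_sub_le_lowerF_mul hν hsupp hq hβ hfin hd.hasDerivAt
  refine le_of_mul_le_mul_right ?_ (by linarith : 0 < 1 - deriv (fun y => (beta ν y).toReal) q)
  linarith

theorem exists_differentiableAt_toReal_beta (hν : ν ≠ 0) (hsupp : ν (Ioo 0 1)ᶜ = 0) {a b : ℝ}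
    (hab : a < b) (hfin : ∀ y ∈ Ioo a b, beta ν y ≠ ⊤ ∧ beta ν y ≠ ⊥) :
    ∃ q ∈ Ioo a b, DifferentiableAt ℝ (fun y => (beta ν y).toReal) q := by
  have hae := (antitoneOn_toReal_beta hν hsupp hfin).neg.ae_differentiableWithinAt measurableSet_Ioo
  have : (ae (volume.restrict (Ioo a b))).NeBot := by
    rw [ae_neBot, Ne, Measure.restrict_eq_zero, Real.volume_Ioo]
    simpa using hab
  obtain ⟨q, hd, hq⟩ := (hae.and (ae_restrict_mem measurableSet_Ioo)).exists
  exact ⟨q, hq, by simpa using (hd.differentiableAt (Ioo_mem_nhds hq.1 hq.2)).neg⟩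

theorem qBar_le_lowerF_of_left (hν : ν ≠ 0) (hsupp : ν (Ioo 0 1)ᶜ = 0) {a : ℝ} (ha : a < qBar ν)
    (hβ : ∀ q ∈ Ioo a (qBar ν), beta ν q = lowerBeta ν q) : qBar ν ≤ lowerF ν := by
  rcases (qBar_nonneg hν hsupp).eq_or_lt with h0 | h0
  · exact h0 ▸ lowerF_nonneg
  refine le_of_forall_lt_imp_le_of_dense fun c hc => ?_
  obtain ⟨b, hb, hbq⟩ := exists_between (max_lt (max_lt ha h0) hc)
  obtain ⟨⟨hab, h0b⟩, hcb⟩ := max_lt_iff.1 hb |>.imp_left max_lt_iff.1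
  have hfin : ∀ y ∈ Ioo b (qBar ν), beta ν y ≠ ⊤ ∧ beta ν y ≠ ⊥ := fun y hy =>
    ⟨beta_ne_top hν hsupp (h0b.trans hy.1).le, beta_ne_bot hν hsupp hy.2⟩
  obtain ⟨q, hq, hd⟩ := exists_differentiableAt_toReal_beta hν hsupp hbq hfin
  exact (hcb.trans hq.1).le.trans (le_lowerF_of_differentiableAt hν hsupp (h0b.trans hq.1).le
    (hβ q ⟨hab.trans hq.1, hq.2⟩) (le_toReal_beta_of_lt_qBar hν hsupp hq.2 (hfin q hq).1)
    (mem_of_superset (Ioo_mem_nhds hq.1 hq.2) hfin) hd)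

theorem qBar_le_toReal_beta (hν : ν ≠ 0) (hsupp : ν (Ioo 0 1)ᶜ = 0)
    (hfin : ∀ᶠ q in 𝓝 (qBar ν), beta ν q ≠ ⊤)
    (hcont : ContinuousAt (fun q => (beta ν q).toReal) (qBar ν)) :
    qBar ν ≤ (beta ν (qBar ν)).toReal := by
  refine le_of_tendsto_of_tendsto (tendsto_id.mono_left nhdsWithin_le_nhds)
    (hcont.tendsto.mono_left nhdsWithin_le_nhds : Tendsto _ (𝓝[<] (qBar ν)) _) ?_
  filter_upwards [self_mem_nhdsWithin, nhdsWithin_le_nhds hfin] with q hq htop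
  exact le_toReal_beta_of_lt_qBar hν hsupp hq htop

theorem qBar_le_lowerF (hν : ν ≠ 0) (hsupp : ν (Ioo 0 1)ᶜ = 0) (hreg : LqRegular ν) :
    qBar ν ≤ lowerF ν := by
  rcases hreg with ⟨ε, hε, hβ⟩ | ⟨hβ, hfin, hd⟩
  · exact qBar_le_lowerF_of_left hν hsupp (sub_lt_self _ hε) hβ
  · exact le_lowerF_of_differentiableAt hν hsupp (qBar_nonneg hν hsupp) hβ
      (qBar_le_toReal_beta hν hsupp (hfin.mono fun _ h => h.1) hd.continuousAt) hfin hd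

end Regular

/-! ### Growth of the eigenvalue counting function -/

theorem eventually_add_log_mul_rpow_le {q s : ℝ} (hq : 0 ≤ q) (hqs : q < s) (A B C : ℝ) :
    ∀ᶠ x in atTop, A + (B + C * Real.log x) * x ^ q ≤ x ^ s := by
  have hconst (D : ℝ) {r : ℝ} (hr : 0 < r) : (fun _ => D) =o[atTop] fun x : ℝ => x ^ r :=
    Asymptotics.isLittleO_const_left.2
      (Or.inr (tendsto_norm_atTop_atTop.comp (tendsto_rpow_atTop hr)))
  have hlog := (hconst B (sub_pos.2 hqs)).add
    ((isLittleO_log_rpow_atTop (sub_pos.2 hqs)).const_mul_left C)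
  have hprod := hlog.mul_isBigO (Asymptotics.isBigO_refl (fun x : ℝ => x ^ q) atTop)
  have hsum : (fun x => A + (B + C * Real.log x) * x ^ q) =o[atTop] fun x : ℝ => x ^ s := by
    refine (hconst A (hq.trans_lt hqs)).add (hprod.congr' .rfl ?_)
    filter_upwards [eventually_gt_atTop 0] with x hx
    rw [← Real.rpow_add hx, sub_add_cancel]
  filter_upwards [hsum.def one_pos, eventually_ge_atTop 0] with x hx hx0
  rw [one_mul, Real.norm_of_nonneg (Real.rpow_nonneg hx0 s)] at hx
  exact (Real.le_norm_self _).trans hx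

theorem eventually_atTop_of_geometric_cover {P : ℝ → Prop} {a y : ℝ} (ha : 0 < a) (hy : 1 < y)
    (h : ∀ᶠ n : ℕ in atTop, ∀ x ∈ Ico (a * y ^ n) (a * y ^ (n + 1)), P x) :
    ∀ᶠ x in atTop, P x := by
  obtain ⟨N, hN⟩ := eventually_atTop.1 h
  filter_upwards [eventually_ge_atTop (a * y ^ N)] with x hx
  have hNx : y ^ N ≤ x / a := (le_div_iff₀' ha).2 hx
  obtain ⟨n, hnx, hxn⟩ := exists_nat_pow_near ((one_le_pow₀ hy.le).trans hNx) hy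
  have hNn : N < n + 1 := (pow_lt_pow_iff_right₀ hy).1 (hNx.trans_lt hxn)
  exact hN n (Nat.lt_succ_iff.1 hNn) x ⟨(le_div_iff₀' ha).1 hnx, (div_lt_iff₀' ha).1 hxn⟩

section Spectral

variable {ν : Measure ℝ} {x s q t c α : ℝ}

theorem log_ofReal_rpow (hx : 1 < x) (s : ℝ) :
    ENNReal.log (ENNReal.ofReal (x ^ s)) = s * (Real.log x : ℝ) := by
  have hx0 : 0 < x := one_pos.trans hx
  rw [ENNReal.log_ofReal_of_pos (Real.rpow_pos_of_pos hx0 s), Real.log_rpow hx0, EReal.coe_mul]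

theorem spectralRatio_le_iff (hx : 1 < x) :
    spectralRatio ν x ≤ s ↔ (eigenCount ν x : ℝ≥0∞) ≤ ENNReal.ofReal (x ^ s) := by
  rw [spectralRatio, EReal.div_le_iff_le_mul (EReal.coe_pos.2 (Real.log_pos hx))
    (EReal.coe_ne_top _), mul_comm, ← log_ofReal_rpow hx, ENNReal.log_le_log_iff]

theorem le_spectralRatio_iff (hx : 1 < x) :
    (s : EReal) ≤ spectralRatio ν x ↔ ENNReal.ofReal (x ^ s) ≤ eigenCount ν x := by
  rw [spectralRatio, EReal.le_div_iff_mul_le (EReal.coe_pos.2 (Real.log_pos hx))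
    (EReal.coe_ne_top _), ← log_ofReal_rpow hx, ENNReal.log_le_log_iff]

theorem eventually_le_coarseCount (hc : 0 ≤ c) (h : c < liminf (coarseRatio ν α) atTop) :
    ∀ᶠ n : ℕ in atTop, (2 : ℝ) ^ (n * c) ≤ coarseCount ν α n := by
  filter_upwards [eventually_lt_of_lt_liminf h (isBoundedUnder_ge_coarseRatio α),
    eventually_gt_atTop 0] with n hlt hn
  have hmax : (2 : ℝ) ^ (n * c) < max 1 (coarseCount ν α n : ℝ) := by
    rw [← two_rpow_coarseRatio hn]
    exact Real.rpow_lt_rpow_of_exponent_lt one_lt_two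
      (mul_lt_mul_of_pos_left hlt (Nat.cast_pos.2 hn))
  exact ((lt_max_iff.1 hmax).resolve_left
    (Real.one_le_rpow one_le_two (by positivity)).not_gt).le

theorem eventually_mul_rpow_add_le_coarseCount (hα : 0 < α) (hc : 0 ≤ c)
    (h : c * (1 + α) < liminf (coarseRatio ν α) atTop) (A B : ℝ) (hB : 0 ≤ B) :
    ∀ᶠ n : ℕ in atTop, A * ((2 : ℝ) ^ (1 + α)) ^ (n * c) + B ≤ coarseCount ν α n := by
  obtain ⟨a, hca, ha⟩ := exists_between h
  have ha0 : 0 ≤ a := (mul_nonneg hc (by positivity)).trans hca.le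
  have hpow : Tendsto (fun n : ℕ => (2 : ℝ) ^ (n * (a - c * (1 + α)))) atTop atTop :=
    (tendsto_rpow_atTop_of_base_gt_one 2 one_lt_two).comp
      (tendsto_natCast_atTop_atTop.atTop_mul_const (sub_pos.2 hca))
  filter_upwards [eventually_le_coarseCount ha0 ha, hpow.eventually_ge_atTop (A + B)] with n hn hAB
  set u : ℝ := ((2 : ℝ) ^ (1 + α)) ^ (n * c)
  have hu : 1 ≤ u := Real.one_le_rpow (Real.one_le_rpow one_le_two (by positivity)) (by positivity)
  calc A * u + B ≤ (A + B) * u := by nlinarith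
    _ ≤ 2 ^ (n * (a - c * (1 + α))) * u := by gcongr
    _ = 2 ^ (n * a) := by
      have hu_eq : u = 2 ^ ((1 + α) * (n * c)) := (Real.rpow_mul zero_le_two _ _).symm
      rw [hu_eq, ← Real.rpow_add two_pos]
      ring_nf
    _ ≤ coarseCount ν α n := hn

variable [IsFiniteMeasure ν]

theorem card_filter_heavy_le_rpow (hν : ν ≠ 0) (hsupp : ν (Ioo 0 1)ᶜ = 0) (hq : 0 ≤ q)
    (ht : 0 < t) {n : ℕ} (hn : 0 < n) (hβ : betaN ν n q ≤ q) :
    (((Finset.range (2 ^ n)).filter fun k => t ≤ ν.real (dyadic n k) / 2 ^ n).card : ℝ) ≤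
      t ^ (-q) := by
  have h2n : (0 : ℝ) < 2 ^ n := by positivity
  have hle := calc
    _ ≤ partSum ν n q := card_mul_rpow_le_partSum (mul_pos ht h2n) hq
      (fun _ hk => Finset.mem_range.1 (Finset.mem_filter.1 hk).1)
      fun _ hk => (le_div_iff₀ h2n).1 (Finset.mem_filter.1 hk).2
    _ ≤ ((2 : ℝ) ^ n) ^ q := by
      rw [partSum_eq_rpow hν hsupp hn, ← Real.rpow_natCast, ← Real.rpow_mul zero_le_two]
      gcongr
      exact one_le_two
  rw [Real.mul_rpow ht.le h2n.le, ← mul_assoc,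
    mul_le_iff_le_one_left (Real.rpow_pos_of_pos h2n q)] at hle
  rwa [Real.rpow_neg ht.le, ← one_div, le_div_iff₀ (by positivity)]

theorem exists_card_heavy_le (hν : ν ≠ 0) (hsupp : ν (Ioo 0 1)ᶜ = 0) (hq : 0 ≤ q)
    (hβ : ∀ᶠ n in atTop, betaN ν n q ≤ q) :
    ∃ C : ℝ, ∀ t > 0, ∀ N : ℕ, ((heavy ν t N).card : ℝ) ≤ C + N * t ^ (-q) := by
  obtain ⟨n₀, hn₀⟩ := eventually_atTop.1 (hβ.and (eventually_gt_atTop 0))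
  refine ⟨∑ n ∈ Finset.range n₀, 2 ^ n, fun t ht N => ?_⟩
  have hlevel : ∀ n, (((Finset.range (2 ^ n)).filter fun k =>
      t ≤ ν.real (dyadic n k) / 2 ^ n).card : ℝ) ≤ (if n < n₀ then 2 ^ n else 0) + t ^ (-q) := by
    intro n
    split_ifs with h
    · have hcard : (((Finset.range (2 ^ n)).filter fun k =>
          t ≤ ν.real (dyadic n k) / 2 ^ n).card : ℝ) ≤ 2 ^ n := by
        exact_mod_cast (Finset.card_filter_le _ _).trans_eq (Finset.card_range _)
      exact hcard.trans (le_add_of_nonneg_right (by positivity))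
    · obtain ⟨hβn, hn⟩ := hn₀ n (not_lt.1 h)
      simpa using card_filter_heavy_le_rpow hν hsupp hq ht hn hβn
  rw [heavy, Finset.card_sigma, Nat.cast_sum]
  refine (Finset.sum_le_sum fun n _ => hlevel n).trans ?_
  rw [Finset.sum_add_distrib, Finset.sum_const, Finset.card_range, nsmul_eq_mul,
    ← Finset.sum_filter]
  refine add_le_add_left (Finset.sum_le_sum_of_subset_of_nonneg (fun n hn => ?_) fun _ _ _ => by
    positivity) _
  exact Finset.mem_range.2 (Finset.mem_filter.1 hn).2

theorem exists_eigenCount_le (hν : ν ≠ 0) (hsupp : ν (Ioo 0 1)ᶜ = 0) (hq : 0 ≤ q)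
    (hβ : ∀ᶠ n in atTop, betaN ν n q ≤ q) : ∃ A B C : ℝ, ∀ᶠ x in atTop,
      (eigenCount ν x : ℝ≥0∞) ≤ ENNReal.ofReal (A + (B + C * Real.log x) * x ^ q) := by
  have : NeZero ν := ⟨hν⟩
  obtain ⟨A, hA⟩ := exists_card_heavy_le hν hsupp hq hβ
  set m := ν.real univ
  have hm : 0 < m := measureReal_univ_pos
  refine ⟨A, (Real.logb 2 (2 * m) + 1) * 2 ^ q, 2 ^ q / Real.log 2, ?_⟩
  filter_upwards [eventually_ge_atTop (1 / (2 * m)), eventually_gt_atTop 0] with x hmx hx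
  have hlogb : 0 ≤ Real.logb 2 (2 * m * x) :=
    Real.logb_nonneg one_lt_two (by rwa [div_le_iff₀' (by positivity)] at hmx)
  set N := ⌈Real.logb 2 (2 * m * x)⌉₊
  have hN : m / 2 ^ N ≤ 1 / (2 * x) := by
    have h2N : 2 * m * x ≤ 2 ^ (N : ℝ) :=
      (Real.logb_le_iff_le_rpow one_lt_two (by positivity)).1 (Nat.le_ceil _)
    rw [Real.rpow_natCast] at h2N
    rw [div_le_div_iff₀ (by positivity) (by positivity)]
    linarith
  have hcount : (eigenCount ν x : ℝ≥0∞) ≤ (heavy ν (1 / (2 * x)) N).card := by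
    exact_mod_cast eigenCount_le_card_heavy hx.le (by field_simp; norm_num) hN
  refine hcount.trans ?_
  rw [← ENNReal.ofReal_natCast]
  refine ENNReal.ofReal_le_ofReal ((hA _ (by positivity) N).trans ?_)
  have hNle : (N : ℝ) ≤ Real.logb 2 (2 * m) + Real.log x / Real.log 2 + 1 := by
    rw [Real.log_div_log, ← Real.logb_mul (by positivity) hx.ne']
    exact (Nat.ceil_lt_add_one hlogb).le
  have hpow : (1 / (2 * x)) ^ (-q) = 2 ^ q * x ^ q := by
    rw [one_div, Real.inv_rpow (by positivity), Real.rpow_neg (by positivity), inv_inv,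
      Real.mul_rpow zero_le_two hx.le]
  calc A + N * (1 / (2 * x)) ^ (-q)
      ≤ A + (Real.logb 2 (2 * m) + Real.log x / Real.log 2 + 1) * (2 ^ q * x ^ q) := by
        rw [hpow]; gcongr
    _ = _ := by ring

theorem upperSpectralDim_le_qBar (hν : ν ≠ 0) (hsupp : ν (Ioo 0 1)ᶜ = 0) :
    upperSpectralDim ν ≤ qBar ν := by
  refine EReal.le_of_forall_lt_iff_le.1 fun s hs => ?_
  obtain ⟨q, hq, hqs⟩ := exists_between (EReal.coe_lt_coe_iff.1 hs)
  have hq0 : 0 ≤ q := (qBar_nonneg hν hsupp).trans hq.le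
  obtain ⟨A, B, C, hABC⟩ := exists_eigenCount_le hν hsupp hq0 (eventually_betaN_le hν hsupp hq)
  refine limsup_le_of_le (by isBoundedDefault) ?_
  filter_upwards [hABC, eventually_add_log_mul_rpow_le hq0 hqs A B C, eventually_gt_atTop 1]
    with x hx hgrowth hx1
  exact (spectralRatio_le_iff hx1).2 (hx.trans (ENNReal.ofReal_le_ofReal hgrowth))

theorem lowerSpectralDim_nonneg (hν : ν ≠ 0) (hsupp : ν (Ioo 0 1)ᶜ = 0) :
    0 ≤ lowerSpectralDim ν := by
  obtain ⟨x₀, hx₀⟩ := exists_one_le_eigenCount hν hsupp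
  refine le_liminf_of_le (by isBoundedDefault) ?_
  filter_upwards [eventually_ge_atTop x₀, eventually_gt_atTop 1] with x hx hx1
  rw [← EReal.coe_zero, le_spectralRatio_iff hx1, Real.rpow_zero, ENNReal.ofReal_one]
  exact_mod_cast hx₀.trans (eigenCount_mono hx)

theorem le_lowerSpectralDim (hα : 0 < α) (hc : 0 ≤ c)
    (h : c < liminf (coarseRatio ν α) atTop / (1 + α)) : (c : EReal) ≤ lowerSpectralDim ν := by
  rw [lt_div_iff₀ (by positivity)] at h
  set y : ℝ := 2 ^ (1 + α)
  have hy1 : 1 < y := Real.one_lt_rpow one_lt_two (by positivity)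
  refine le_liminf_of_le (by isBoundedDefault) ?_
  refine (eventually_gt_atTop 1).mp (eventually_atTop_of_geometric_cover two_pos hy1 ?_)
  filter_upwards [eventually_mul_rpow_add_le_coarseCount hα hc h (3 * (2 * y) ^ c) 2 zero_le_two]
    with n hn x ⟨hnx, hxn⟩ hx1
  rw [le_spectralRatio_iff hx1]
  have hxc : x ^ c ≤ (2 * y) ^ c * y ^ (n * c) := by
    rw [Real.rpow_natCast_mul (by positivity), ← Real.mul_rpow (by positivity) (by positivity)]
    exact Real.rpow_le_rpow (by positivity) (hxn.le.trans_eq (by ring)) hc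
  have hcount : (coarseCount ν α n : ℕ∞) ≤ 3 * eigenCount ν x + 2 := by
    refine (coarseCount_le α n).trans ?_
    gcongr
    refine eigenCount_mono ?_
    rwa [Real.rpow_mul_natCast zero_le_two]
  cases hE : eigenCount ν x using ENat.recTopCoe with
  | top => simp
  | coe m =>
    rw [hE] at hcount
    have hm : (coarseCount ν α n : ℝ) ≤ 3 * m + 2 := by exact_mod_cast hcount
    rw [ENat.toENNReal_coe, ← ENNReal.ofReal_natCast]
    exact ENNReal.ofReal_le_ofReal (by linarith)

theorem lowerF_le_lowerSpectralDim (hν : ν ≠ 0) (hsupp : ν (Ioo 0 1)ᶜ = 0) :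
    (lowerF ν : EReal) ≤ lowerSpectralDim ν := by
  refine EReal.ge_of_forall_gt_iff_ge.1 fun c hc => ?_
  rcases lt_or_ge c 0 with hc0 | hc0
  · exact (EReal.coe_nonpos.2 hc0.le).trans (lowerSpectralDim_nonneg hν hsupp)
  · obtain ⟨⟨α, hα⟩, hcα⟩ := exists_lt_of_lt_ciSup (EReal.coe_lt_coe_iff.1 hc)
    exact le_lowerSpectralDim hα hc0 hcα

end Spectral

end KreinFeller

end

theorem theorem1p2 (ν : MeasureTheory.Measure ℝ) [MeasureTheory.IsFiniteMeasure ν]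
    (hν : ν ≠ 0) (hsupp : ν (Set.Ioo 0 1)ᶜ = 0) (hreg : KreinFeller.LqRegular ν) :
    KreinFeller.MFRegular ν ∧ KreinFeller.HasSpectralDim ν (KreinFeller.qBar ν) := by
  have hF := KreinFeller.qBar_le_lowerF hν hsupp hreg
  have hU := KreinFeller.upperF_le_qBar hν hsupp
  have hlow := (EReal.coe_le_coe_iff.2 hF).trans (KreinFeller.lowerF_le_lowerSpectralDim hν hsupp)
  have hup := KreinFeller.upperSpectralDim_le_qBar hν hsupp
  have hle : KreinFeller.lowerSpectralDim ν ≤ KreinFeller.upperSpectralDim ν :=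
    Filter.liminf_le_limsup
  exact ⟨le_antisymm KreinFeller.lowerF_le_upperF (hU.trans hF),
    le_antisymm (hle.trans hup) hlow, le_antisymm hup (hlow.trans hle)⟩
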